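/- Notation. All Hilbert spaces are complex, of arbitrary dimension, and operators are linear and bounded. Two operators $T_1:X_1\to Y_1$ and $T_2:X_2\to Y_2$ are \emph{topologically equivalent} if there are isomorphisms of topological vector spaces $U:X_1\to X_2$ and $V:Y_1\to Y_2$ (onto) with $T_2U=VT_1$. For an operator $T:H\to G$ between Hilbert spaces let $\mathcal E_T$ be the spectral measure of the positive semi-definite operator $\sqrt{T^*T}=\int_{[0,\infty[}\lambda\,d\mathcal E_T(\lambda)$ on $H$, and let its \emph{dimension spectral measure} be the cardinal-valued function $\mathcal D_T(B)=\dim \mathcal E_T(B)H$ on the Borel sets $B\subseteq[0,\infty[$, where $\dim$ is the Hilbert dimension (the cardinality of an orthonormal basis). Let $(S_k)$ be a countable partition of $]0,\infty[$ into Borel sets and let $a_k\in\,]0,\infty[$ be points for which there is a $K>1$ such that $K^{-1}\le y/z\le K$ for all $k$ and all $y,z\in S_k\cup\{a_k\}$. Let $T_1:H_1\to G_1$ and $T_2:H_2\to G_2$ be operators between Hilbert spaces. (1) If $\mathcal D_{T_1}(\{0\})=\mathcal D_{T_2}(\{0\})$ and $\mathcal D_{T_1}(S_k)=\mathcal D_{T_2}(S_k)$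 for all $k$, then $T_1$ and $T_2$, as operators $H_1\to\overline{T_1H_1}$ and $H_2\to\overline{T_2H_2}$ into the closures of their ranges, are topologically equivalent. If moreover $\dim (T_1H_1)^\perp=\dim (T_2H_2)^\perp$ (for instance if both ranges are dense), then $T_1:H_1\to G_1$ and $T_2:H_2\to G_2$ themselves are topologically equivalent. (2) The mass of each $S_k$ may be transferred to $a_k$: there is an operator $T':H_1\to G_1$ topologically equivalent to $T_1$ such that for every Borel set $B\subseteq[0,\infty[$ $$\mathcal D_{T'}(B)=\mathcal D_{T_1}(B\cap\{0\})+\sum_{k:\,a_k\in B}\mathcal D_{T_1}(S_k).$$ -/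

import Mathlib

open Set MeasureTheory
open scoped NNReal ENNReal

universe u₁ v₁ u₂ v₂

noncomputable section

/-- Two operators `T₁ : X₁ → Y₁` and `T₂ : X₂ → Y₂` are topologically equivalent: there are
isomorphisms (of topological vector spaces) `U : X₁ → X₂` and `V : Y₁ → Y₂` onto with
`T₂ = V T₁ U⁻¹`, that is `T₂ U = V T₁`. -/
def TopologicallyEquivalent {X₁ Y₁ X₂ Y₂ : Type*}
    [NormedAddCommGroup X₁] [NormedSpace ℂ X₁] [NormedAddCommGroup Y₁] [NormedSpace ℂ Y₁]
    [NormedAddCommGroup X₂] [NormedSpace ℂ X₂] [NormedAddCommGroup Y₂] [NormedSpace ℂ Y₂]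
    (T₁ : X₁ →L[ℂ] Y₁) (T₂ : X₂ →L[ℂ] Y₂) : Prop :=
  ∃ (U : X₁ ≃L[ℂ] X₂) (V : Y₁ ≃L[ℂ] Y₂), ∀ x, T₂ (U x) = V (T₁ x)

/-- The operator `T`, regarded as an operator into the closure of its range. -/
def toClosureRange {H G : Type*}
    [NormedAddCommGroup H] [InnerProductSpace ℂ H] [NormedAddCommGroup G] [InnerProductSpace ℂ G]
    (T : H →L[ℂ] G) : H →L[ℂ] (LinearMap.range (T : H →ₗ[ℂ] G)).topologicalClosure :=
  T.codRestrict _ fun x =>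
    Submodule.le_topologicalClosure _ (LinearMap.mem_range_self (T : H →ₗ[ℂ] G) x)

/-- The Hilbert dimension of a Hilbert space: the cardinality of a Hilbert (orthonormal) basis. -/
def hilbertDim (H : Type u₁) [NormedAddCommGroup H] [InnerProductSpace ℂ H] [CompleteSpace H] :
    Cardinal.{u₁} :=
  Cardinal.mk (Classical.choose (exists_hilbertBasis ℂ H) : Set H)

/-- A spectral measure (decomposition of unity) on the Borel subsets of `[0,∞)` with values in the
orthogonal projections of the Hilbert space `H`. By convention it is `0` on non-Borel sets. -/
structure SpectralMeasure (H : Type*)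
    [NormedAddCommGroup H] [InnerProductSpace ℂ H] [CompleteSpace H] where
  /-- The operator attached to a set. -/
  proj : Set ℝ≥0 → H →L[ℂ] H
  proj_of_not_measurableSet : ∀ S, ¬ MeasurableSet S → proj S = 0
  isStarProjection : ∀ S, MeasurableSet S → IsStarProjection (proj S)
  proj_empty : proj ∅ = 0
  proj_univ : proj univ = 1
  proj_inter : ∀ S S', MeasurableSet S → MeasurableSet S' → proj (S ∩ S') = proj S * proj S'
  hasSum_proj : ∀ S : ℕ → Set ℝ≥0, (∀ n, MeasurableSet (S n)) →
    Pairwise (fun m n => Disjoint (S m) (S n)) →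
    ∀ x, HasSum (fun n => proj (S n) x) (proj (⋃ n, S n) x)

namespace SpectralMeasure

variable {H : Type*} [NormedAddCommGroup H] [InnerProductSpace ℂ H] [CompleteSpace H]

theorem isStarProjection_proj (E : SpectralMeasure H) (S : Set ℝ≥0) :
    IsStarProjection (E.proj S) := by
  by_cases hS : MeasurableSet S
  · exact E.isStarProjection S hS
  · rw [E.proj_of_not_measurableSet S hS]
    exact IsStarProjection.zero _

theorem re_inner_proj (E : SpectralMeasure H) (S : Set ℝ≥0) (x : H) :
    (inner ℂ x (E.proj S x)).re = ‖E.proj S x‖ ^ 2 := by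
  have h := E.isStarProjection_proj S
  have h1 : E.proj S (E.proj S x) = E.proj S x :=
    congrArg (fun P : H →L[ℂ] H => P x) h.isIdempotentElem.eq
  have h2 : ContinuousLinearMap.adjoint (E.proj S) = E.proj S := h.isSelfAdjoint
  calc (inner ℂ x (E.proj S x)).re
      = (inner ℂ x (ContinuousLinearMap.adjoint (E.proj S) (E.proj S x))).re := by rw [h2, h1]
    _ = (inner ℂ (E.proj S x) (E.proj S x)).re := by
        rw [ContinuousLinearMap.adjoint_inner_right]
    _ = ‖E.proj S x‖ ^ 2 := inner_self_eq_norm_sq (𝕜 := ℂ) (E.proj S x)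

/-- The finite positive measure `S ↦ ⟨E(S) x, x⟩` on `[0,∞)`. -/
def scalarMeasure (E : SpectralMeasure H) (x : H) : Measure ℝ≥0 :=
  Measure.ofMeasurable (fun S _ => ENNReal.ofReal (inner ℂ x (E.proj S x)).re)
    (by simp [E.proj_empty])
    (by
      intro f hf hd
      have h := E.hasSum_proj f hf hd x
      have h' : HasSum (fun n => (inner ℂ x (E.proj (f n) x)).re)
          (inner ℂ x (E.proj (⋃ n, f n) x)).re :=
        Complex.reCLM.hasSum ((innerSL ℂ x).hasSum h)
      rw [← h'.tsum_eq]
      exact ENNReal.ofReal_tsum_of_nonneg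
        (fun n => by rw [re_inner_proj]; positivity) h'.summable)

theorem scalarMeasure_apply (E : SpectralMeasure H) (x : H) {S : Set ℝ≥0}
    (hS : MeasurableSet S) :
    E.scalarMeasure x S = ENNReal.ofReal (inner ℂ x (E.proj S x)).re :=
  Measure.ofMeasurable_apply S hS

/-- `E` is the spectral decomposition of `A`, i.e. `A = ∫ λ dE(λ)` in the weak sense:
`⟨A x, x⟩ = ∫ λ d⟨E(λ) x, x⟩` for all `x` (by polarization, this determines all
`⟨A x, x'⟩`). -/
def IsDecompositionOf (E : SpectralMeasure H) (A : H →L[ℂ] H) : Prop :=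
  ∀ x : H, Integrable (fun t : ℝ≥0 => (t : ℝ)) (E.scalarMeasure x) ∧
    inner ℂ (A x) x = ((∫ t : ℝ≥0, (t : ℝ) ∂(E.scalarMeasure x) : ℝ) : ℂ)

/-- The subspace `E(S) H`. -/
def subspace (E : SpectralMeasure H) (S : Set ℝ≥0) : Submodule ℂ H :=
  LinearMap.range (E.proj S : H →ₗ[ℂ] H)

instance (E : SpectralMeasure H) (S : Set ℝ≥0) : CompleteSpace (E.subspace S) :=
  (ContinuousLinearMap.IsIdempotentElem.isClosed_range
    (E.isStarProjection_proj S).isIdempotentElem).completeSpace_coe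

end SpectralMeasure

section

variable {H : Type u₁} [NormedAddCommGroup H] [InnerProductSpace ℂ H] [CompleteSpace H]
  {G : Type v₁} [NormedAddCommGroup G] [InnerProductSpace ℂ G] [CompleteSpace G]

/-- The positive semi-definite operator `√(T* T)` on `H`. -/
def absOperator (T : H →L[ℂ] G) : H →L[ℂ] H :=
  CFC.sqrt (ContinuousLinearMap.adjoint T ∘L T)

open Classical in
/-- The dimension spectral measure of `T`: the cardinal-valued function `S ↦ dim E(S) H`, where `E`
is the spectral decomposition of `√(T* T)`. By the spectral theorem `E` exists and is unique, so
the value `0` in the other case is never taken. -/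
def dimSpectralMeasure (T : H →L[ℂ] G) (S : Set ℝ≥0) : Cardinal.{u₁} :=
  if h : ∃ E : SpectralMeasure H, E.IsDecompositionOf (absOperator T) then
    hilbertDim (h.choose.subspace S)
  else 0

end

end

/-! Up to topological equivalence an operator is governed by the norms ‖T x‖, which equal ‖A x‖ for
A = √(T*T). If an isomorphism U of the domains makes ‖T₂ U x‖ and ‖T₁ x‖ comparable, then T₁ x ↦ T₂
U x is well defined and extends to an isomorphism of the closures of the ranges
(`exists_equiv_closure_range_of_norm_le`). A unitary between the orthogonal complements of the
ranges extends it to the whole targets (`exists_equiv_of_norm_le`).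

On E(S_k)H the operator A lies between a_k/K and K a_k in norm, and A commutes with E(S_k). By
Pythagoras ‖A x‖² is therefore comparable with ∑ a_k² ‖E(S_k) x‖², the cell {0} contributing
nothing. For (1), equal dimensions give a unitary that carries E₁(S_k) to E₂(S_k)
(`exists_unitary_intertwining`), so the norms are comparable with the constant K².

For (2), the diagonal operator D = ∑ a_k E(S_k) has norms comparable with those of A. Both are
self-adjoint, so A R = D for an invertible R (`exists_equiv_factor`). With T' = T₁ R the positive
operator √(T'*T') is D itself, and the eigenspaces of D determine its spectral measure
(`proj_diagonal`).

Existence of the spectral measure comes from the continuous functional calculus Φ: the Riesz theorem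
represents f ↦ ⟨Φ(f)x, x⟩ by a measure μ_x, the map f ↦ Φ(f)x is isometric on L²(μ_x), and its
extension to indicator functions gives the projections. -/

/-! ### Spectral projections from a continuous functional calculus, and the spectral theorem -/

section BorelCalculus

set_option linter.unusedSectionVars false

open Filter Topology

variable {H : Type*} [NormedAddCommGroup H] [InnerProductSpace ℂ H] [CompleteSpace H]
  {X : Type*} [TopologicalSpace X] [CompactSpace X] [TopologicalSpace.MetrizableSpace X]
  [MeasurableSpace X] [BorelSpace X]

theorem starAlgHom_continuousMap_isSelfAdjoint (Φ : C(X, ℝ) →⋆ₐ[ℝ] (H →L[ℂ] H)) (f : C(X, ℝ)) :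
    IsSelfAdjoint (Φ f) :=
  (show IsSelfAdjoint f by ext; simp).map Φ

theorem re_inner_starAlgHom_sq (Φ : C(X, ℝ) →⋆ₐ[ℝ] (H →L[ℂ] H)) (f : C(X, ℝ)) (x : H) :
    (inner ℂ x (Φ (f * f) x)).re = ‖Φ f x‖ ^ 2 := by
  have h : ContinuousLinearMap.adjoint (Φ f) = Φ f := starAlgHom_continuousMap_isSelfAdjoint Φ f
  rw [map_mul, mul_apply_eq_comp]
  nth_rewrite 1 [← h]
  rw [ContinuousLinearMap.adjoint_inner_right]
  exact inner_self_eq_norm_sq (𝕜 := ℂ) _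

/-- The positive functional `f ↦ ⟨Φ(f) x, x⟩`. -/
noncomputable def vectorFunctional (Φ : C(X, ℝ) →⋆ₐ[ℝ] (H →L[ℂ] H)) (x : H) :
    CompactlySupportedContinuousMap X ℝ →ₚ[ℝ] ℝ :=
  PositiveLinearMap.mk₀
    { toFun := fun f => (inner ℂ x (Φ (f : C(X, ℝ)) x)).re
      map_add' := fun f g => by
        have : ((f + g : CompactlySupportedContinuousMap X ℝ) : C(X, ℝ)) = (f : C(X, ℝ)) + g := rfl
        simp [this]
      map_smul' := fun c f => by
        have : ((c • f : CompactlySupportedContinuousMap X ℝ) : C(X, ℝ)) = c • (f : C(X, ℝ)) := rfl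
        rw [this, map_smul, smul_apply, ← Complex.coe_smul, inner_smul_right]
        simp }
    (fun f hf => by
      -- Positivity: a nonnegative f is the square of √f, so its value is ‖Φ(√f) x‖².
      set g : C(X, ℝ) := ⟨fun t => √(f t), by fun_prop⟩ with hg
      have : (f : C(X, ℝ)) = g * g := by
        ext t
        simp [hg, Real.mul_self_sqrt (show 0 ≤ f t from hf t)]
      change 0 ≤ (inner ℂ x (Φ (f : C(X, ℝ)) x)).re
      rw [this, re_inner_starAlgHom_sq]
      positivity)

/-- The measure representing `f ↦ ⟨Φ(f) x, x⟩`. -/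
noncomputable def vectorMeasure (Φ : C(X, ℝ) →⋆ₐ[ℝ] (H →L[ℂ] H)) (x : H) : Measure X :=
  RealRMK.rieszMeasure (vectorFunctional Φ x)

instance (Φ : C(X, ℝ) →⋆ₐ[ℝ] (H →L[ℂ] H)) (x : H) : IsFiniteMeasure (vectorMeasure Φ x) := by
  unfold vectorMeasure; infer_instance

theorem integral_vectorMeasure (Φ : C(X, ℝ) →⋆ₐ[ℝ] (H →L[ℂ] H)) (x : H) (f : C(X, ℝ)) :
    ∫ t, f t ∂(vectorMeasure Φ x) = (inner ℂ x (Φ f x)).re :=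
  RealRMK.integral_rieszMeasure (vectorFunctional Φ x)
    (CompactlySupportedContinuousMap.continuousMapEquiv f)

/-- Both squares are ∫ f² dμ_x = ⟨Φ(f²)x, x⟩. This isometry is what allows f ↦ Φ(f)x to be extended
from continuous functions to L². -/
theorem norm_toLp_vectorMeasure (Φ : C(X, ℝ) →⋆ₐ[ℝ] (H →L[ℂ] H)) (x : H) (f : C(X, ℝ)) :
    ‖ContinuousMap.toLp 2 (vectorMeasure Φ x) ℝ f‖ = ‖Φ f x‖ := by
  rw [← sq_eq_sq₀ (norm_nonneg _) (norm_nonneg _), ← re_inner_starAlgHom_sq,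
    ← integral_vectorMeasure, ← real_inner_self_eq_norm_sq, ContinuousMap.inner_toLp]
  simp

/-- The map `f ↦ Φ(f) x`. -/
noncomputable def vectorMap (Φ : C(X, ℝ) →⋆ₐ[ℝ] (H →L[ℂ] H)) (x : H) : C(X, ℝ) →ₗ[ℝ] H where
  toFun := fun f => Φ f x
  map_add' := by simp
  map_smul' := by simp

/-- The isometry `L²(μ_x) → H` extending `f ↦ Φ(f) x`. -/
noncomputable def vectorIsometry (Φ : C(X, ℝ) →⋆ₐ[ℝ] (H →L[ℂ] H)) (x : H) :
    Lp ℝ 2 (vectorMeasure Φ x) →L[ℝ] H :=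
  (vectorMap Φ x).extendOfNorm
    (ContinuousMap.toLp (E := ℝ) 2 (vectorMeasure Φ x) ℝ).toLinearMap

theorem vectorIsometry_toLp (Φ : C(X, ℝ) →⋆ₐ[ℝ] (H →L[ℂ] H)) (x : H) (f : C(X, ℝ)) :
    vectorIsometry Φ x (ContinuousMap.toLp 2 (vectorMeasure Φ x) ℝ f) = Φ f x := by
  have h : ∃ C, ∀ g : C(X, ℝ), ‖vectorMap Φ x g‖ ≤
      C * ‖(ContinuousMap.toLp (E := ℝ) 2 (vectorMeasure Φ x) ℝ).toLinearMap g‖ := by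
    refine ⟨1, fun g => ?_⟩
    rw [one_mul]
    exact (norm_toLp_vectorMeasure Φ x g).ge
  have hd := ContinuousMap.toLp_denseRange ℝ (vectorMeasure Φ x) ℝ (p := 2) (by simp)
  exact LinearMap.extendOfNorm_eq hd h f

theorem norm_vectorIsometry (Φ : C(X, ℝ) →⋆ₐ[ℝ] (H →L[ℂ] H)) (x : H)
    (u : Lp ℝ 2 (vectorMeasure Φ x)) : ‖vectorIsometry Φ x u‖ = ‖u‖ := by
  refine (ContinuousMap.toLp_denseRange ℝ (vectorMeasure Φ x) ℝ (p := 2) (by simp)).induction_on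
    (p := fun u => ‖vectorIsometry Φ x u‖ = ‖u‖) u ?_ ?_
  · exact isClosed_eq (by fun_prop) (by fun_prop)
  · intro f
    rw [vectorIsometry_toLp, norm_toLp_vectorMeasure]

/-- The value at `x` of the spectral projection of a set. -/
noncomputable def spectralVector (Φ : C(X, ℝ) →⋆ₐ[ℝ] (H →L[ℂ] H)) {S : Set X} (hS : MeasurableSet S) (x : H) :
    H :=
  vectorIsometry Φ x (indicatorConstLp 2 hS (measure_ne_top _ _) 1)

theorem norm_spectralVector_sq (Φ : C(X, ℝ) →⋆ₐ[ℝ] (H →L[ℂ] H)) {S : Set X} (hS : MeasurableSet S)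
    (x : H) : ‖spectralVector Φ hS x‖ ^ 2 = (vectorMeasure Φ x).real S := by
  rw [spectralVector, norm_vectorIsometry, norm_indicatorConstLp (by simp) (by simp)]
  simp only [norm_one, one_mul, ENNReal.toReal_ofNat]
  rw [← Real.sqrt_eq_rpow, Real.sq_sqrt measureReal_nonneg]

/-- Used with a ν that dominates the measures of several vectors at once: one sequence then computes
the spectral projection at each of them, and algebraic identities pass from Φ(f_n) to the limit. -/
theorem exists_seq_continuousMap_tendsto_indicator {S : Set X} (hS : MeasurableSet S)
    (ν : Measure X) [IsFiniteMeasure ν] :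
    ∃ f : ℕ → C(X, ℝ), Tendsto
      (fun n => eLpNorm (S.indicator (fun _ => (1 : ℝ)) - ⇑(f n)) 2 ν) atTop (𝓝 0) := by
  have h : ∀ n : ℕ, ∃ f : C(X, ℝ),
      eLpNorm (S.indicator (fun _ => (1 : ℝ)) - ⇑f) 2 ν ≤ ((n : ℝ≥0∞) + 1)⁻¹ := by
    intro n
    obtain ⟨g, hg, -⟩ := (memLp_indicator_const 2 hS (1 : ℝ)
      (Or.inr (measure_ne_top ν S))).exists_boundedContinuous_eLpNorm_sub_le (by simp)
      (ε := ((n : ℝ≥0∞) + 1)⁻¹) (by simp)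
    exact ⟨g.toContinuousMap, hg⟩
  choose f hf using h
  refine ⟨f, tendsto_of_tendsto_of_tendsto_of_le_of_le tendsto_const_nhds ?_
    (fun _ => zero_le) hf⟩
  have := ENNReal.tendsto_inv_nat_nhds_zero.comp (tendsto_add_atTop_nat 1)
  simpa [Function.comp_def] using this

theorem tendsto_toLp_indicatorConstLp {S : Set X} (hS : MeasurableSet S) {μ ν : Measure X}
    [IsFiniteMeasure μ] (hμν : μ ≤ ν) {f : ℕ → C(X, ℝ)}
    (hf : Tendsto (fun n => eLpNorm (S.indicator (fun _ => (1 : ℝ)) - ⇑(f n)) 2 ν) atTop (𝓝 0)) :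
    Tendsto (fun n => ContinuousMap.toLp 2 μ ℝ (f n)) atTop
      (𝓝 (indicatorConstLp 2 hS (measure_ne_top μ S) 1)) := by
  rw [tendsto_iff_edist_tendsto_0]
  refine tendsto_of_tendsto_of_tendsto_of_le_of_le tendsto_const_nhds hf
    (fun _ => zero_le) (fun n => ?_)
  rw [edist_comm, Lp.edist_def]
  refine le_trans (le_of_eq (eLpNorm_congr_ae ?_)) (eLpNorm_mono_measure _ hμν)
  exact indicatorConstLp_coeFn.sub (ContinuousMap.coeFn_toLp μ (f n))

theorem tendsto_spectralVector (Φ : C(X, ℝ) →⋆ₐ[ℝ] (H →L[ℂ] H)) {S : Set X}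
    (hS : MeasurableSet S) {ν : Measure X} {f : ℕ → C(X, ℝ)}
    (hf : Tendsto (fun n => eLpNorm (S.indicator (fun _ => (1 : ℝ)) - ⇑(f n)) 2 ν) atTop (𝓝 0))
    {x : H} (hx : vectorMeasure Φ x ≤ ν) :
    Tendsto (fun n => Φ (f n) x) atTop (𝓝 (spectralVector Φ hS x)) := by
  have := ((vectorIsometry Φ x).continuous.tendsto _).comp
    (tendsto_toLp_indicatorConstLp hS hx hf)
  simp only [Function.comp_def, vectorIsometry_toLp] at this
  exact this

theorem re_inner_spectralVector (Φ : C(X, ℝ) →⋆ₐ[ℝ] (H →L[ℂ] H)) {S : Set X}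
    (hS : MeasurableSet S) (x : H) :
    (inner ℂ x (spectralVector Φ hS x)).re = (vectorMeasure Φ x).real S := by
  obtain ⟨f, hf⟩ := exists_seq_continuousMap_tendsto_indicator hS (vectorMeasure Φ x)
  have h1 : Tendsto (fun n => (inner ℂ x (Φ (f n) x)).re) atTop
      (𝓝 (inner ℂ x (spectralVector Φ hS x)).re) :=
    ((Complex.reCLM.continuous.comp (innerSL ℂ x).continuous).tendsto _).comp
      (tendsto_spectralVector Φ hS hf le_rfl)
  have h2 : Tendsto (fun n => (inner ℂ x (Φ (f n) x)).re) atTop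
      (𝓝 ((vectorMeasure Φ x).real S)) := by
    -- The L² pairing with the constant 1 is the integral, so the integrals of f_n tend to the
    -- measure of S.
    have h3 := ((innerSL ℝ (ContinuousMap.toLp 2 (vectorMeasure Φ x) ℝ
      (1 : C(X, ℝ)))).continuous.tendsto _).comp (tendsto_toLp_indicatorConstLp hS le_rfl hf)
    have h4 : ContinuousMap.toLp 2 (vectorMeasure Φ x) ℝ (1 : C(X, ℝ)) =
        indicatorConstLp 2 MeasurableSet.univ (measure_ne_top _ _) 1 := by
      refine Lp.ext ((ContinuousMap.coeFn_toLp _ _).trans ?_)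
      refine EventuallyEq.trans ?_ indicatorConstLp_coeFn.symm
      simp [EventuallyEq]
    have h5 : innerSL ℝ (ContinuousMap.toLp 2 (vectorMeasure Φ x) ℝ (1 : C(X, ℝ)))
        (indicatorConstLp 2 hS (measure_ne_top _ S) 1) = (vectorMeasure Φ x).real S := by
      rw [h4, innerSL_apply_apply, L2.real_inner_indicatorConstLp_one_indicatorConstLp_one,
        univ_inter]
    rw [h5] at h3
    refine h3.congr fun n => ?_
    simp only [Function.comp, innerSL_apply_apply]
    rw [ContinuousMap.inner_toLp, ← integral_vectorMeasure]
    simp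
  exact tendsto_nhds_unique h1 h2

/-- The spectral projection of a measurable set. -/
noncomputable def spectralProjection (Φ : C(X, ℝ) →⋆ₐ[ℝ] (H →L[ℂ] H)) {S : Set X} (hS : MeasurableSet S) :
    H →L[ℂ] H :=
  LinearMap.mkContinuousOfExistsBound
    { toFun := spectralVector Φ hS
      map_add' := fun x y => by
        obtain ⟨f, hf⟩ := exists_seq_continuousMap_tendsto_indicator hS
          (vectorMeasure Φ x + vectorMeasure Φ y + vectorMeasure Φ (x + y))
        have hx := tendsto_spectralVector Φ hS hf (x := x)
          (Measure.le_add_right (Measure.le_add_right le_rfl))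
        have hy := tendsto_spectralVector Φ hS hf (x := y)
          (Measure.le_add_right (Measure.le_add_left le_rfl))
        have hxy := tendsto_spectralVector Φ hS hf (x := x + y) (Measure.le_add_left le_rfl)
        refine tendsto_nhds_unique hxy ?_
        simpa using hx.add hy
      map_smul' := fun c x => by
        obtain ⟨f, hf⟩ := exists_seq_continuousMap_tendsto_indicator hS
          (vectorMeasure Φ x + vectorMeasure Φ (c • x))
        have hx := tendsto_spectralVector Φ hS hf (x := x) (Measure.le_add_right le_rfl)
        have hcx := tendsto_spectralVector Φ hS hf (x := c • x) (Measure.le_add_left le_rfl)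
        refine tendsto_nhds_unique hcx ?_
        simpa using hx.const_smul c }
    ⟨1, fun x => by
      change ‖spectralVector Φ hS x‖ ≤ 1 * ‖x‖
      rw [← sq_le_sq₀ (norm_nonneg _) (by positivity), norm_spectralVector_sq, one_mul]
      calc (vectorMeasure Φ x).real S ≤ (vectorMeasure Φ x).real univ :=
            measureReal_mono (subset_univ _)
        _ = ‖x‖ ^ 2 := by
            have := integral_vectorMeasure Φ x 1
            simp only [ContinuousMap.one_apply, integral_const, smul_eq_mul, mul_one, map_one,
              one_apply_eq_self] at this
            rw [this]
            exact inner_self_eq_norm_sq (𝕜 := ℂ) x⟩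

theorem re_inner_spectralProjection (Φ : C(X, ℝ) →⋆ₐ[ℝ] (H →L[ℂ] H)) {S : Set X}
    (hS : MeasurableSet S) (x : H) :
    (inner ℂ x (spectralProjection Φ hS x)).re = (vectorMeasure Φ x).real S :=
  re_inner_spectralVector Φ hS x

theorem norm_spectralProjection_sq (Φ : C(X, ℝ) →⋆ₐ[ℝ] (H →L[ℂ] H)) {S : Set X}
    (hS : MeasurableSet S) (x : H) :
    ‖spectralProjection Φ hS x‖ ^ 2 = (vectorMeasure Φ x).real S :=
  norm_spectralVector_sq Φ hS x

theorem spectralProjection_isSelfAdjoint (Φ : C(X, ℝ) →⋆ₐ[ℝ] (H →L[ℂ] H)) {S : Set X}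
    (hS : MeasurableSet S) : IsSelfAdjoint (spectralProjection Φ hS) := by
  rw [ContinuousLinearMap.isSelfAdjoint_iff_isSymmetric]
  intro x y
  obtain ⟨f, hf⟩ := exists_seq_continuousMap_tendsto_indicator hS
    (vectorMeasure Φ x + vectorMeasure Φ y)
  have hx := tendsto_spectralVector Φ hS hf (x := x) (Measure.le_add_right le_rfl)
  have hy := tendsto_spectralVector Φ hS hf (x := y) (Measure.le_add_left le_rfl)
  refine tendsto_nhds_unique (hx.inner (𝕜 := ℂ) tendsto_const_nhds) ?_
  refine ((tendsto_const_nhds (x := x)).inner (𝕜 := ℂ) hy).congr fun n => ?_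
  exact ((ContinuousLinearMap.isSelfAdjoint_iff_isSymmetric.1
    (starAlgHom_continuousMap_isSelfAdjoint Φ (f n))) x y).symm

/-- Polarization. It reduces identities between spectral projections to identities between the
measures μ_x. -/
theorem IsSelfAdjoint.ext_re_inner {A B : H →L[ℂ] H} (hA : IsSelfAdjoint A) (hB : IsSelfAdjoint B)
    (h : ∀ x, (inner ℂ x (A x)).re = (inner ℂ x (B x)).re) : A = B := by
  have hs : ∀ {C : H →L[ℂ] H}, IsSelfAdjoint C → ∀ x, (inner ℂ x (C x)).im = 0 := fun hC x =>
    (ContinuousLinearMap.isSelfAdjoint_iff_isSymmetric.1 hC).im_inner_self_apply x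
  refine ContinuousLinearMap.coe_injective ((ext_inner_map _ _).1 fun x => ?_)
  have h1 : inner ℂ x (A x) = inner ℂ x (B x) :=
    Complex.ext (h x) (by rw [hs hA, hs hB])
  rw [ContinuousLinearMap.coe_coe, ContinuousLinearMap.coe_coe, ← inner_conj_symm, h1,
    inner_conj_symm]

/-- With P self-adjoint, ⟨x, P²x⟩ = ‖P x‖², and both ‖P x‖² and ⟨x, P x⟩ are μ_x(S). Hence P² = P by
comparison of quadratic forms. -/
theorem spectralProjection_isStarProjection (Φ : C(X, ℝ) →⋆ₐ[ℝ] (H →L[ℂ] H)) {S : Set X}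
    (hS : MeasurableSet S) : IsStarProjection (spectralProjection Φ hS) := by
  have hs := spectralProjection_isSelfAdjoint Φ hS
  refine ⟨?_, hs⟩
  refine IsSelfAdjoint.ext_re_inner (by simpa using hs.mul_self_nonneg.isSelfAdjoint) hs fun x => ?_
  have hsym : ∀ y z, inner ℂ (spectralProjection Φ hS y) z = inner ℂ y (spectralProjection Φ hS z) :=
    ContinuousLinearMap.isSelfAdjoint_iff_isSymmetric.1 hs
  rw [re_inner_spectralProjection, ← norm_spectralProjection_sq, mul_apply_eq_comp, ← hsym]
  exact inner_self_eq_norm_sq (𝕜 := ℂ) _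

theorem spectralProjection_add (Φ : C(X, ℝ) →⋆ₐ[ℝ] (H →L[ℂ] H)) {S S' U : Set X}
    (hS : MeasurableSet S) (hS' : MeasurableSet S') (hU : MeasurableSet U)
    (hd : Disjoint S S') (h : U = S ∪ S') :
    spectralProjection Φ hU = spectralProjection Φ hS + spectralProjection Φ hS' := by
  subst h
  refine IsSelfAdjoint.ext_re_inner (spectralProjection_isSelfAdjoint Φ _)
    ((spectralProjection_isSelfAdjoint Φ _).add (spectralProjection_isSelfAdjoint Φ _)) fun x => ?_
  rw [add_apply, inner_add_right, Complex.add_re]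
  simp only [re_inner_spectralProjection]
  exact measureReal_union hd hS'

theorem spectralProjection_empty (Φ : C(X, ℝ) →⋆ₐ[ℝ] (H →L[ℂ] H)) :
    spectralProjection Φ MeasurableSet.empty = 0 := by
  ext x
  have := norm_spectralProjection_sq Φ MeasurableSet.empty x
  simpa using this

theorem spectralProjection_univ (Φ : C(X, ℝ) →⋆ₐ[ℝ] (H →L[ℂ] H)) :
    spectralProjection Φ MeasurableSet.univ = 1 := by
  refine IsSelfAdjoint.ext_re_inner (spectralProjection_isSelfAdjoint Φ _)
    (IsSelfAdjoint.one _) fun x => ?_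
  have := integral_vectorMeasure Φ x 1
  simp only [ContinuousMap.one_apply, integral_const, smul_eq_mul, mul_one, map_one] at this
  rw [re_inner_spectralProjection, this]

/-- The projections P and Q add up to the projection of the union. Idempotence of P + Q forces PQ +
QP = 0. -/
theorem spectralProjection_mul_of_disjoint (Φ : C(X, ℝ) →⋆ₐ[ℝ] (H →L[ℂ] H)) {S S' : Set X}
    (hS : MeasurableSet S) (hS' : MeasurableSet S') (hd : Disjoint S S') :
    spectralProjection Φ hS * spectralProjection Φ hS' = 0 := by
  have h := (spectralProjection_isStarProjection Φ (hS.union hS')).isIdempotentElem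
  rw [spectralProjection_add Φ hS hS' (hS.union hS') hd rfl] at h
  have hP := (spectralProjection_isStarProjection Φ hS).isIdempotentElem.eq
  have hQ := (spectralProjection_isStarProjection Φ hS').isIdempotentElem.eq
  have h := h.eq
  generalize spectralProjection Φ hS = P at *
  generalize spectralProjection Φ hS' = Q at *
  have h0 : P * Q + Q * P = 0 := by
    have : (P + Q) * (P + Q) = P * P + Q * Q + (P * Q + Q * P) := by noncomm_ring
    rw [this, hP, hQ] at h
    simpa using h
  -- Multiplying by P on the left and on the right shows PQ = -PQP = QP, whence 2PQ = 0.
  have h1 : P * Q + P * Q * P = 0 := by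
    have := congrArg (P * ·) h0
    simpa [mul_add, ← mul_assoc, hP] using this
  have h2 : P * Q * P + Q * P = 0 := by
    have := congrArg (· * P) h0
    simpa [add_mul, mul_assoc, hP] using this
  have h3 : P * Q = Q * P := by
    rw [eq_neg_of_add_eq_zero_left h1, eq_neg_of_add_eq_zero_right h2]
  rw [← h3] at h0
  have : (2 : ℂ) • (P * Q) = 0 := by rw [two_smul]; exact h0
  simpa using this

theorem spectralProjection_inter (Φ : C(X, ℝ) →⋆ₐ[ℝ] (H →L[ℂ] H)) {S S' : Set X}
    (hS : MeasurableSet S) (hS' : MeasurableSet S') :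
    spectralProjection Φ (hS.inter hS') = spectralProjection Φ hS * spectralProjection Φ hS' := by
  rw [spectralProjection_add Φ (hS.inter hS') (hS.diff hS') hS
      (disjoint_left.2 fun t h h' => h'.2 h.2) (inter_union_sdiff S S').symm,
    spectralProjection_add Φ (hS.inter hS') (hS'.diff hS) hS'
      (disjoint_left.2 fun t h h' => h'.2 h.1) (by rw [inter_comm, inter_union_sdiff]),
    mul_add, add_mul, add_mul, spectralProjection_mul_of_disjoint Φ (hS.diff hS') (hS.inter hS')
      (disjoint_left.2 fun t h h' => h.2 h'.2),
    spectralProjection_mul_of_disjoint Φ (hS.inter hS') (hS'.diff hS)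
      (disjoint_left.2 fun t h h' => h'.2 h.1),
    spectralProjection_mul_of_disjoint Φ (hS.diff hS') (hS'.diff hS)
      (disjoint_left.2 fun t h h' => h.2 h'.1),
    (spectralProjection_isStarProjection Φ (hS.inter hS')).isIdempotentElem.eq]
  simp

theorem spectralProjection_hasSum (Φ : C(X, ℝ) →⋆ₐ[ℝ] (H →L[ℂ] H)) {S : ℕ → Set X}
    (hS : ∀ n, MeasurableSet (S n)) (hd : Pairwise (fun m n => Disjoint (S m) (S n))) (x : H) :
    HasSum (fun n => spectralProjection Φ (hS n) x)
      (spectralProjection Φ (MeasurableSet.iUnion hS) x) := by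
  have hfin : ∀ s : Finset ℕ, spectralProjection Φ (s.measurableSet_biUnion fun n _ => hS n) =
      ∑ n ∈ s, spectralProjection Φ (hS n) := by
    intro s
    refine IsSelfAdjoint.ext_re_inner (spectralProjection_isSelfAdjoint Φ _)
      (isSelfAdjoint_sum _ fun n _ => spectralProjection_isSelfAdjoint Φ _) fun x => ?_
    rw [sum_apply, inner_sum, Complex.re_sum]
    simp only [re_inner_spectralProjection]
    exact measureReal_biUnion_finset (fun i _ j _ hij => hd hij) fun n _ => hS n
  -- The error of a partial sum is the projection of the remaining union, so its squared norm is the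
  -- measure of that union. Countable additivity of μ_x then gives convergence.
  have hnorm : ∀ s : Finset ℕ, ‖(∑ n ∈ s, spectralProjection Φ (hS n) x) -
      spectralProjection Φ (MeasurableSet.iUnion hS) x‖ ^ 2 =
      (vectorMeasure Φ x).real (⋃ n, S n) - ∑ n ∈ s, (vectorMeasure Φ x).real (S n) := by
    intro s
    have hsub : (⋃ n ∈ s, S n) ⊆ ⋃ n, S n := iUnion₂_subset fun n _ => subset_iUnion S n
    have hm := s.measurableSet_biUnion fun n (_ : n ∈ s) => hS n
    rw [norm_sub_rev, ← sum_apply, ← hfin,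
      spectralProjection_add Φ hm ((MeasurableSet.iUnion hS).diff hm) (MeasurableSet.iUnion hS)
        disjoint_sdiff_right (union_sdiff_cancel hsub).symm,
      add_apply, add_sub_cancel_left, norm_spectralProjection_sq,
      measureReal_sdiff hsub hm]
    congr 1
    exact measureReal_biUnion_finset (fun i _ j _ hij => hd hij) fun n _ => hS n
  have hsum : HasSum (fun n => (vectorMeasure Φ x).real (S n))
      ((vectorMeasure Φ x).real (⋃ n, S n)) := by
    rw [measureReal_def, measure_iUnion hd hS]
    have hne : ∑' n, vectorMeasure Φ x (S n) ≠ ⊤ := by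
      rw [← measure_iUnion hd hS]
      exact measure_ne_top _ _
    rw [ENNReal.tsum_toReal_eq fun n => measure_ne_top _ _]
    exact ENNReal.hasSum_toReal hne
  rw [HasSum, SummationFilter.unconditional_filter, tendsto_iff_norm_sub_tendsto_zero]
  have h0 : Tendsto (fun s : Finset ℕ => ‖(∑ n ∈ s, spectralProjection Φ (hS n) x) -
      spectralProjection Φ (MeasurableSet.iUnion hS) x‖ ^ 2) atTop (𝓝 0) := by
    simp only [hnorm]
    have := (tendsto_const_nhds (x := (vectorMeasure Φ x).real (⋃ n, S n))).sub hsum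
    simpa using this
  simpa using h0.sqrt

theorem spectralProjection_congr (Φ : C(X, ℝ) →⋆ₐ[ℝ] (H →L[ℂ] H)) {S S' : Set X} (h : S = S')
    (hS : MeasurableSet S) (hS' : MeasurableSet S') :
    spectralProjection Φ hS = spectralProjection Φ hS' := by
  subst h; rfl

open Classical in
/-- The spectral measure on `[0,∞)` that a star homomorphism on `C(X)` and a function on `X`
define. -/
noncomputable def SpectralMeasure.ofStarAlgHom (Φ : C(X, ℝ) →⋆ₐ[ℝ] (H →L[ℂ] H)) {ψ : X → ℝ≥0}
    (hψ : Measurable ψ) : SpectralMeasure H where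
  proj S := if hS : MeasurableSet S then spectralProjection Φ (hψ hS) else 0
  proj_of_not_measurableSet S hS := dif_neg hS
  isStarProjection S hS := by
    rw [dif_pos hS]; exact spectralProjection_isStarProjection Φ _
  proj_empty := by
    rw [dif_pos MeasurableSet.empty, ← spectralProjection_empty Φ]
  proj_univ := by
    rw [dif_pos MeasurableSet.univ, ← spectralProjection_univ Φ]
    rfl
  proj_inter S S' hS hS' := by
    rw [dif_pos hS, dif_pos hS', dif_pos (hS.inter hS'), ← spectralProjection_inter]
    rfl
  hasSum_proj S hS hd x := by
    simp only [dif_pos (hS _), dif_pos (MeasurableSet.iUnion hS)]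
    have h := spectralProjection_hasSum Φ (fun n => hψ (hS n)) (fun m n hmn => (hd hmn).preimage ψ) x
    rwa [spectralProjection_congr Φ preimage_iUnion.symm _ (hψ (MeasurableSet.iUnion hS))] at h

theorem SpectralMeasure.scalarMeasure_ofStarAlgHom (Φ : C(X, ℝ) →⋆ₐ[ℝ] (H →L[ℂ] H)) {ψ : X → ℝ≥0}
    (hψ : Measurable ψ) (x : H) :
    (SpectralMeasure.ofStarAlgHom Φ hψ).scalarMeasure x = (vectorMeasure Φ x).map ψ := by
  ext S hS
  rw [scalarMeasure_apply _ _ hS, Measure.map_apply hψ hS]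
  simp only [ofStarAlgHom, dif_pos hS]
  rw [re_inner_spectralProjection, measureReal_def, ENNReal.ofReal_toReal (measure_ne_top _ _)]

end BorelCalculus

/-- The spectral theorem for bounded positive operators. -/
theorem exists_isDecompositionOf {H : Type*} [NormedAddCommGroup H] [InnerProductSpace ℂ H]
    [CompleteSpace H] (A : H →L[ℂ] H) (hA : 0 ≤ A) :
    ∃ E : SpectralMeasure H, E.IsDecompositionOf A := by
  have hs : IsSelfAdjoint A := .of_nonneg hA
  let Φ : C(spectrum ℝ A, ℝ) →⋆ₐ[ℝ] (H →L[ℂ] H) := cfcHom (R := ℝ) hs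
  have : CompactSpace (spectrum ℝ A) := isCompact_iff_compactSpace.1 (spectrum.isCompact A)
  let f : C(spectrum ℝ A, ℝ) := (ContinuousMap.id ℝ).restrict (spectrum ℝ A)
  -- The truncation `toNNReal` changes nothing, since the spectrum of a positive operator is
  -- nonnegative.
  have hψ : Measurable (fun t : spectrum ℝ A => (t : ℝ).toNNReal) := by fun_prop
  have hf : ∀ t : spectrum ℝ A, (((t : ℝ).toNNReal : ℝ≥0) : ℝ) = f t := fun t =>
    Real.coe_toNNReal _ (spectrum_nonneg_of_nonneg hA t.2)
  refine ⟨SpectralMeasure.ofStarAlgHom Φ hψ, fun x => ?_⟩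
  rw [SpectralMeasure.scalarMeasure_ofStarAlgHom]
  constructor
  · rw [integrable_map_measure (by fun_prop) hψ.aemeasurable]
    simp only [Function.comp_def, hf]
    exact f.continuous.integrable_of_hasCompactSupport (.of_compactSpace _)
  · rw [integral_map hψ.aemeasurable (by fun_prop)]
    simp only [hf]
    rw [integral_vectorMeasure, show Φ f = A from cfcHom_id hs]
    have hsym := ContinuousLinearMap.isSelfAdjoint_iff_isSymmetric.1 hs
    have h : inner ℂ (A x) x = inner ℂ x (A x) := hsym x x
    rw [h]
    exact Complex.ext (Complex.ofReal_re _).symm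
      ((hsym.im_inner_self_apply x).trans (Complex.ofReal_im _).symm)

/-! ### Invariance of the Hilbert dimension -/

section HilbertDimension

open Cardinal

theorem HilbertBasis.eq_zero_of_forall_inner {𝕜 E ι : Type*} [RCLike 𝕜] [NormedAddCommGroup E]
    [InnerProductSpace 𝕜 E] (b : HilbertBasis ι 𝕜 E) {x : E} (h : ∀ i, inner 𝕜 (b i) x = 0) :
    x = 0 := by
  refine b.repr.injective (lp.ext (funext fun i => ?_))
  rw [b.repr_apply_apply, h, map_zero]
  rfl

/-- Each vector of b' is non-orthogonal to some vector of b, while by summability of the Fourier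
coefficients each vector of b is non-orthogonal to at most countably many vectors of b'. -/
theorem HilbertBasis.mk_le_mk_of_infinite {ι ι' : Type u₁} {E : Type*} [NormedAddCommGroup E]
    [InnerProductSpace ℂ E] [Infinite ι] (b : HilbertBasis ι ℂ E) (b' : HilbertBasis ι' ℂ E) :
    #ι' ≤ #ι := by
  have hex : ∀ i' : ι', ∃ i : ι, inner ℂ (b i) (b' i') ≠ 0 := by
    intro i'
    by_contra! h
    exact b'.orthonormal.ne_zero i' (b.eq_zero_of_forall_inner h)
  choose f hf using hex
  calc #ι' ≤ #ι * ℵ₀ := by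
        refine mk_le_mk_mul_of_mk_preimage_le f fun i => ?_
        rw [le_aleph0_iff_set_countable]
        refine (b'.summable_inner_mul_inner (b i) (b i)).countable_support.mono ?_
        rintro i' rfl
        have h := hf i'
        exact mul_ne_zero h (by rwa [← inner_conj_symm, map_ne_zero])
    _ = #ι := mul_aleph0_eq (aleph0_le_mk ι)

theorem HilbertBasis.finite_of_finite {ι ι' : Type u₁} {E : Type*} [NormedAddCommGroup E]
    [InnerProductSpace ℂ E] [Finite ι] (b : HilbertBasis ι ℂ E) (b' : HilbertBasis ι' ℂ E) :
    Finite ι' := by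
  have := Fintype.ofFinite ι
  have : FiniteDimensional ℂ E := b.toOrthonormalBasis.toBasis.finiteDimensional_of_finite
  exact b'.orthonormal.linearIndependent.finite

/-- Any two Hilbert bases have the same cardinality. -/
theorem HilbertBasis.mk_eq_mk {ι ι' : Type u₁} {E : Type*} [NormedAddCommGroup E]
    [InnerProductSpace ℂ E] (b : HilbertBasis ι ℂ E) (b' : HilbertBasis ι' ℂ E) :
    #ι = #ι' := by
  rcases finite_or_infinite ι with hι | hι
  · have hι' := b.finite_of_finite b'
    have := Fintype.ofFinite ι
    have := Fintype.ofFinite ι'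
    exact mk_eq_mk_of_basis' b.toOrthonormalBasis.toBasis b'.toOrthonormalBasis.toBasis
  · rcases finite_or_infinite ι' with hι' | hι'
    · exact absurd (b'.finite_of_finite b) (not_finite_iff_infinite.2 hι)
    · exact le_antisymm (b'.mk_le_mk_of_infinite b) (b.mk_le_mk_of_infinite b')

/-- A Hilbert basis whose index set has the Hilbert dimension as its cardinality. -/
theorem exists_hilbertBasis_mk_eq_hilbertDim (H : Type u₁) [NormedAddCommGroup H]
    [InnerProductSpace ℂ H] [CompleteSpace H] :
    ∃ (ι : Type u₁) (_ : HilbertBasis ι ℂ H), #ι = hilbertDim H := by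
  obtain ⟨b, -⟩ := Classical.choose_spec (exists_hilbertBasis ℂ H)
  exact ⟨_, b, rfl⟩

theorem HilbertBasis.mk_eq_hilbertDim {ι H : Type u₁} [NormedAddCommGroup H]
    [InnerProductSpace ℂ H] [CompleteSpace H] (b : HilbertBasis ι ℂ H) : #ι = hilbertDim H := by
  obtain ⟨ι', b', h⟩ := exists_hilbertBasis_mk_eq_hilbertDim H
  rw [← h, b.mk_eq_mk b']

/-- The unitary that maps one Hilbert basis to another. -/
theorem HilbertBasis.exists_linearIsometryEquiv {ι₁ ι₂ H₁ H₂ : Type*}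
    [NormedAddCommGroup H₁] [InnerProductSpace ℂ H₁] [CompleteSpace H₁]
    [NormedAddCommGroup H₂] [InnerProductSpace ℂ H₂] [CompleteSpace H₂]
    (b₁ : HilbertBasis ι₁ ℂ H₁) (b₂ : HilbertBasis ι₂ ℂ H₂) (e : ι₁ ≃ ι₂) :
    ∃ W : H₁ ≃ₗᵢ[ℂ] H₂, ∀ i, W (b₁ i) = b₂ (e i) := by
  classical
  have ho : Orthonormal ℂ (b₂ ∘ e) := b₂.orthonormal.comp e e.injective
  have hd : ⊤ ≤ (Submodule.span ℂ (Set.range (b₂ ∘ e))).topologicalClosure := by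
    rw [e.surjective.range_comp]
    exact b₂.dense_span.ge
  let b := HilbertBasis.mk ho hd
  refine ⟨b₁.repr.trans b.repr.symm, fun i => ?_⟩
  rw [LinearIsometryEquiv.trans_apply, b₁.repr_self, b.repr_symm_single]
  exact congrFun (HilbertBasis.coe_mk ho hd) i

theorem nonempty_linearIsometryEquiv_of_hilbertDim_eq
    {H₁ : Type u₁} [NormedAddCommGroup H₁] [InnerProductSpace ℂ H₁] [CompleteSpace H₁]
    {H₂ : Type u₂} [NormedAddCommGroup H₂] [InnerProductSpace ℂ H₂] [CompleteSpace H₂]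
    (h : lift.{u₂} (hilbertDim H₁) = lift.{u₁} (hilbertDim H₂)) : Nonempty (H₁ ≃ₗᵢ[ℂ] H₂) := by
  obtain ⟨ι₁, b₁, h₁⟩ := exists_hilbertBasis_mk_eq_hilbertDim H₁
  obtain ⟨ι₂, b₂, h₂⟩ := exists_hilbertBasis_mk_eq_hilbertDim H₂
  rw [← h₁, ← h₂] at h
  obtain ⟨e⟩ := lift_mk_eq'.1 h
  obtain ⟨W, -⟩ := b₁.exists_linearIsometryEquiv b₂ e
  exact ⟨W⟩

/-- An orthonormal family in a closed subspace that is total there has the dimension of the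
subspace as its cardinality. -/
theorem Orthonormal.mk_eq_hilbertDim {ι H : Type u₁} [NormedAddCommGroup H]
    [InnerProductSpace ℂ H] {K : Submodule ℂ H} [CompleteSpace K] {v : ι → H}
    (hv : Orthonormal ℂ v) (hK : ∀ i, v i ∈ K)
    (h : ∀ x ∈ K, (∀ i, inner ℂ (v i) x = 0) → x = 0) : #ι = hilbertDim K := by
  have ho : Orthonormal ℂ (fun i => (⟨v i, hK i⟩ : K)) :=
    hv.codRestrict K hK
  refine (HilbertBasis.mkOfOrthogonalEqBot ho ?_).mk_eq_hilbertDim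
  rw [Submodule.eq_bot_iff]
  intro x hx
  refine Subtype.ext (h x x.2 fun i => ?_)
  exact hx _ (Submodule.subset_span ⟨i, rfl⟩)

end HilbertDimension

/-! ### Topological equivalence from comparable norms -/

section Equivalence

theorem denseRange_toClosureRange {H G : Type*}
    [NormedAddCommGroup H] [InnerProductSpace ℂ H] [NormedAddCommGroup G] [InnerProductSpace ℂ G]
    (T : H →L[ℂ] G) : DenseRange (toClosureRange T) := by
  intro y
  rw [closure_subtype]
  have h := y.2
  rw [← SetLike.mem_coe, Submodule.topologicalClosure_coe] at h
  convert h using 2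
  ext z
  constructor
  · rintro ⟨_, ⟨x, rfl⟩, rfl⟩
    exact ⟨x, rfl⟩
  · rintro ⟨x, rfl⟩
    exact ⟨_, ⟨x, rfl⟩, rfl⟩

/-- The decomposition of the target of an operator into the closure of the range and its orthogonal
complement. -/
theorem exists_equiv_prod_orthogonal_range {H G : Type*}
    [NormedAddCommGroup H] [InnerProductSpace ℂ H] [NormedAddCommGroup G] [InnerProductSpace ℂ G]
    [CompleteSpace G] (T : H →L[ℂ] G) :
    ∃ f : G ≃L[ℂ] (LinearMap.range (T : H →ₗ[ℂ] G)).topologicalClosure ×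
        (LinearMap.range (T : H →ₗ[ℂ] G))ᗮ, ∀ x, f (T x) = (toClosureRange T x, 0) := by
  let K := (LinearMap.range (T : H →ₗ[ℂ] G)).topologicalClosure
  have : CompleteSpace K := (Submodule.isClosed_topologicalClosure _).completeSpace_coe
  let e := LinearIsometryEquiv.ofEq Kᗮ _ (Submodule.orthogonal_closure _)
  let g : G ≃L[ℂ] K × Kᗮ := K.orthogonalDecomposition.toContinuousLinearEquiv.trans
    (WithLp.prodContinuousLinearEquiv 2 ℂ K Kᗮ)
  refine ⟨g.trans ((ContinuousLinearEquiv.refl ℂ K).prodCongr e.toContinuousLinearEquiv),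
    fun x => ?_⟩
  have h₁ : K.orthogonalProjectionOnto (T x) = toClosureRange T x :=
    K.orthogonalProjectionOnto_mem_subspace_eq_self (toClosureRange T x)
  have h₂ : Kᗮ.orthogonalProjectionOnto (T x) = 0 :=
    Submodule.orthogonalProjectionOnto_eq_zero_iff.2
      (K.le_orthogonal_orthogonal (toClosureRange T x).2)
  simp [g, h₁, h₂, K]

variable {H₁ : Type u₁} [NormedAddCommGroup H₁] [InnerProductSpace ℂ H₁]
  {G₁ : Type v₁} [NormedAddCommGroup G₁] [InnerProductSpace ℂ G₁] [CompleteSpace G₁]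
  {H₂ : Type u₂} [NormedAddCommGroup H₂] [InnerProductSpace ℂ H₂]
  {G₂ : Type v₂} [NormedAddCommGroup G₂] [InnerProductSpace ℂ G₂] [CompleteSpace G₂]
  {T₁ : H₁ →L[ℂ] G₁} {T₂ : H₂ →L[ℂ] G₂}

/-- Operators with comparable norms are intertwined by an isomorphism of the closures of their
ranges. -/
theorem exists_equiv_closure_range_of_norm_le (U : H₁ ≃L[ℂ] H₂) {C : ℝ}
    (h₁ : ∀ x, ‖T₂ (U x)‖ ≤ C * ‖T₁ x‖) (h₂ : ∀ x, ‖T₁ x‖ ≤ C * ‖T₂ (U x)‖) :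
    ∃ V : (LinearMap.range (T₁ : H₁ →ₗ[ℂ] G₁)).topologicalClosure ≃L[ℂ]
        (LinearMap.range (T₂ : H₂ →ₗ[ℂ] G₂)).topologicalClosure,
      ∀ x, toClosureRange T₂ (U x) = V (toClosureRange T₁ x) := by
  have : CompleteSpace (LinearMap.range (T₁ : H₁ →ₗ[ℂ] G₁)).topologicalClosure :=
    (Submodule.isClosed_topologicalClosure _).completeSpace_coe
  have : CompleteSpace (LinearMap.range (T₂ : H₂ →ₗ[ℂ] G₂)).topologicalClosure :=
    (Submodule.isClosed_topologicalClosure _).completeSpace_coe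
  have hd₁ : DenseRange (toClosureRange T₁).toLinearMap := denseRange_toClosureRange T₁
  have hd₂ : DenseRange (toClosureRange T₂).toLinearMap := denseRange_toClosureRange T₂
  refine ⟨U.toLinearEquiv.extend (toClosureRange T₁).toLinearMap (toClosureRange T₂).toLinearMap
    hd₁ ⟨C, h₁⟩ hd₂ ⟨C, fun y => ?_⟩, fun x => ?_⟩
  · have := h₂ (U.symm y)
    rwa [U.apply_symm_apply] at this
  · exact (LinearEquiv.extend_eq U.toLinearEquiv (toClosureRange T₁).toLinearMap
      (toClosureRange T₂).toLinearMap hd₁ ⟨C, h₁⟩ hd₂ _ x).symm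

/-- Operators with comparable norms and ranges of the same codimension are topologically
equivalent. -/
theorem exists_equiv_of_norm_le (U : H₁ ≃L[ℂ] H₂) {C : ℝ}
    (h₁ : ∀ x, ‖T₂ (U x)‖ ≤ C * ‖T₁ x‖) (h₂ : ∀ x, ‖T₁ x‖ ≤ C * ‖T₂ (U x)‖)
    (W : (LinearMap.range (T₁ : H₁ →ₗ[ℂ] G₁))ᗮ ≃ₗᵢ[ℂ] (LinearMap.range (T₂ : H₂ →ₗ[ℂ] G₂))ᗮ) :
    ∃ V : G₁ ≃L[ℂ] G₂, ∀ x, T₂ (U x) = V (T₁ x) := by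
  obtain ⟨V, hV⟩ := exists_equiv_closure_range_of_norm_le U h₁ h₂
  obtain ⟨f₁, hf₁⟩ := exists_equiv_prod_orthogonal_range T₁
  obtain ⟨f₂, hf₂⟩ := exists_equiv_prod_orthogonal_range T₂
  refine ⟨(f₁.trans (V.prodCongr W.toContinuousLinearEquiv)).trans f₂.symm, fun x => ?_⟩
  rw [ContinuousLinearEquiv.trans_apply, ContinuousLinearEquiv.trans_apply, hf₁,
    ContinuousLinearEquiv.eq_symm_apply, hf₂, hV]
  simp

end Equivalence

/-! ### Spectral measures and the operators they decompose -/

namespace SpectralMeasure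

variable {H : Type*} [NormedAddCommGroup H] [InnerProductSpace ℂ H] [CompleteSpace H]
  (E : SpectralMeasure H)

theorem proj_proj_self (S : Set ℝ≥0) (x : H) : E.proj S (E.proj S x) = E.proj S x :=
  congrArg (fun P : H →L[ℂ] H => P x) (E.isStarProjection_proj S).isIdempotentElem.eq

theorem inner_proj_left (S : Set ℝ≥0) (x y : H) :
    inner ℂ (E.proj S x) y = inner ℂ x (E.proj S y) :=
  ContinuousLinearMap.isSelfAdjoint_iff_isSymmetric.1 (E.isStarProjection_proj S).isSelfAdjoint x y

theorem mem_subspace_iff {S : Set ℝ≥0} {x : H} : x ∈ E.subspace S ↔ E.proj S x = x :=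
  ⟨by rintro ⟨y, rfl⟩; exact E.proj_proj_self S y, fun h => ⟨x, h⟩⟩

theorem proj_mem_subspace (S : Set ℝ≥0) (x : H) : E.proj S x ∈ E.subspace S :=
  E.mem_subspace_iff.2 (E.proj_proj_self S x)

theorem norm_proj_le (S : Set ℝ≥0) (x : H) : ‖E.proj S x‖ ≤ ‖x‖ := by
  have h : ‖E.proj S x‖ * ‖E.proj S x‖ ≤ ‖x‖ * ‖E.proj S x‖ := by
    rw [← sq, ← E.re_inner_proj]
    exact re_inner_le_norm (𝕜 := ℂ) x (E.proj S x)
  rcases (norm_nonneg (E.proj S x)).eq_or_lt with h0 | h0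
  · rw [← h0]; positivity
  · exact le_of_mul_le_mul_right h h0

variable {S S' : Set ℝ≥0}

theorem proj_proj (hS : MeasurableSet S) (hS' : MeasurableSet S') (x : H) :
    E.proj S (E.proj S' x) = E.proj (S ∩ S') x := by
  rw [E.proj_inter S S' hS hS']; rfl

theorem proj_comm (hS : MeasurableSet S) (hS' : MeasurableSet S') (x : H) :
    E.proj S (E.proj S' x) = E.proj S' (E.proj S x) := by
  rw [E.proj_proj hS hS', E.proj_proj hS' hS, inter_comm]

theorem proj_proj_of_disjoint (hS : MeasurableSet S) (hS' : MeasurableSet S') (h : Disjoint S S')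
    (x : H) : E.proj S (E.proj S' x) = 0 := by
  rw [E.proj_proj hS hS', h.inter_eq, E.proj_empty]; rfl

theorem hasSum_proj_iUnion {J : Type*} [Countable J] {S : J → Set ℝ≥0}
    (hS : ∀ j, MeasurableSet (S j)) (hd : Pairwise (fun i j => Disjoint (S i) (S j))) (x : H) :
    HasSum (fun j => E.proj (S j) x) (E.proj (⋃ j, S j) x) := by
  have := Encodable.ofCountable J
  -- Natural numbers that encode no index carry the empty set, so the sum over them vanishes.
  have h := E.hasSum_proj (fun n => ⋃ j ∈ Encodable.decode₂ J n, S j)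
    (fun n => MeasurableSet.iUnion fun j => MeasurableSet.iUnion fun _ => hS j)
    (Encodable.iUnion_decode₂_disjoint_on hd) x
  rw [Encodable.iUnion_decode₂, ← (Encodable.encode_injective (α := J)).hasSum_iff] at h
  · convert h using 2 with j
    simp
  · intro n hn
    have hnone : ∀ j, j ∉ Encodable.decode₂ J n := fun j hj =>
      hn ⟨j, Encodable.mem_decode₂.1 hj⟩
    simp [hnone, E.proj_empty]

theorem proj_union (hS : MeasurableSet S) (hS' : MeasurableSet S') (h : Disjoint S S') (x : H) :
    E.proj (S ∪ S') x = E.proj S x + E.proj S' x := by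
  have hsum := E.hasSum_proj_iUnion (S := fun b : Bool => cond b S S')
    (by rintro (_ | _) <;> assumption)
    (by rintro (_ | _) (_ | _) hij <;> first | exact absurd rfl hij | exact h | exact h.symm) x
  rw [← union_eq_iUnion] at hsum
  rw [← hsum.tsum_eq, tsum_bool, add_comm]
  rfl

theorem scalarMeasure_apply_eq_norm (x : H) (hS : MeasurableSet S) :
    E.scalarMeasure x S = ENNReal.ofReal (‖E.proj S x‖ ^ 2) := by
  rw [E.scalarMeasure_apply x hS, E.re_inner_proj]

instance (x : H) : IsFiniteMeasure (E.scalarMeasure x) :=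
  ⟨by rw [E.scalarMeasure_apply x .univ]; exact ENNReal.ofReal_lt_top⟩

theorem scalarMeasure_real_univ (x : H) : (E.scalarMeasure x).real univ = ‖x‖ ^ 2 := by
  rw [measureReal_def, E.scalarMeasure_apply_eq_norm x .univ, E.proj_univ,
    ENNReal.toReal_ofReal (by positivity)]
  rfl

theorem ae_mem_of_mem_subspace {x : H} (hS : MeasurableSet S) (hx : x ∈ E.subspace S) :
    ∀ᵐ t ∂(E.scalarMeasure x), t ∈ S := by
  change E.scalarMeasure x Sᶜ = 0
  rw [E.mem_subspace_iff] at hx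
  rw [E.scalarMeasure_apply_eq_norm x hS.compl, ← hx,
    E.proj_proj_of_disjoint hS.compl hS disjoint_compl_left]
  simp

/-- The vectors x and y lie in E(S)H and its orthogonal complement, which every E(B) preserves. The
cross terms in ‖E(B)(x + y)‖² therefore vanish. -/
theorem scalarMeasure_add {x y : H} (hS : MeasurableSet S) (hx : E.proj S x = x)
    (hy : E.proj S y = 0) : E.scalarMeasure (x + y) = E.scalarMeasure x + E.scalarMeasure y := by
  ext B hB
  rw [Measure.add_apply, E.scalarMeasure_apply_eq_norm _ hB, E.scalarMeasure_apply_eq_norm _ hB,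
    E.scalarMeasure_apply_eq_norm _ hB, ← ENNReal.ofReal_add (by positivity) (by positivity),
    map_add, sq, sq, sq, norm_add_sq_eq_norm_sq_add_norm_sq_of_inner_eq_zero (𝕜 := ℂ)]
  rw [E.inner_proj_left, E.proj_proj_self, ← hx, E.inner_proj_left, E.proj_comm hS hB, hy,
    map_zero, inner_zero_right]

namespace IsDecompositionOf

variable {E} {A : H →L[ℂ] H} (hE : E.IsDecompositionOf A)
include hE

theorem re_inner_eq (x : H) : (inner ℂ (A x) x).re = ∫ t : ℝ≥0, (t : ℝ) ∂(E.scalarMeasure x) := by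
  rw [(hE x).2, Complex.ofReal_re]

theorem isSelfAdjoint : IsSelfAdjoint A := by
  rw [ContinuousLinearMap.isSelfAdjoint_iff_isSymmetric,
    LinearMap.isSymmetric_iff_inner_map_self_real]
  intro x
  change (starRingEnd ℂ) (inner ℂ (A x) x) = inner ℂ (A x) x
  rw [(hE x).2, Complex.conj_ofReal]

theorem inner_left (x y : H) : inner ℂ (A x) y = inner ℂ x (A y) :=
  ContinuousLinearMap.isSelfAdjoint_iff_isSymmetric.1 hE.isSelfAdjoint x y

/-- The decomposition is known only as a quadratic form. Additivity of the scalar measures makes the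
form additive on x + y, and self-adjointness turns the cross terms into 2 Re⟨Ax, y⟩. This is the
source of the commutation of A with E. -/
theorem re_inner_eq_zero {x y : H} (hS : MeasurableSet S) (hx : E.proj S x = x)
    (hy : E.proj S y = 0) : (inner ℂ (A x) y).re = 0 := by
  have h := hE.re_inner_eq (x + y)
  rw [E.scalarMeasure_add hS hx hy, integral_add_measure (hE x).1 (hE y).1, ← hE.re_inner_eq,
    ← hE.re_inner_eq, map_add, inner_add_left, inner_add_right, inner_add_right,
    hE.inner_left y x, ← inner_conj_symm y (A x)] at h
  simp only [Complex.add_re, Complex.conj_re] at h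
  linarith

theorem inner_eq_zero {x y : H} (hS : MeasurableSet S) (hx : E.proj S x = x)
    (hy : E.proj S y = 0) : inner ℂ (A x) y = 0 := by
  refine Complex.ext (hE.re_inner_eq_zero hS hx hy) ?_
  -- Replacing x by ix turns the real part into the imaginary part.
  have h := hE.re_inner_eq_zero (x := Complex.I • x) hS (by rw [map_smul, hx]) hy
  rw [map_smul, inner_smul_left] at h
  simpa using h

theorem proj_map_of_mem {x : H} (hS : MeasurableSet S) (hx : E.proj S x = x) :
    E.proj S (A x) = A x := by
  have h : ∀ z, inner ℂ (A x) (z - E.proj S z) = 0 := fun z =>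
    hE.inner_eq_zero hS hx (by rw [map_sub, E.proj_proj_self, sub_self])
  refine (sub_eq_zero.1 (inner_self_eq_zero (𝕜 := ℂ).1 ?_)).symm
  conv_lhs => rw [inner_sub_left]
  rw [h, E.inner_proj_left, map_sub, E.proj_proj_self, sub_self, inner_zero_right, sub_zero]

theorem proj_map (hS : MeasurableSet S) (x : H) : E.proj S (A x) = A (E.proj S x) := by
  -- Tested against y, both sides become the form of E(S) A E(S), because A preserves E(S)H.
  refine ext_inner_right ℂ fun y => ?_
  rw [E.inner_proj_left, hE.inner_left, ← hE.proj_map_of_mem hS (E.proj_proj_self S y),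
    ← E.inner_proj_left, ← hE.inner_left, ← E.inner_proj_left,
    hE.proj_map_of_mem hS (E.proj_proj_self S x)]

theorem re_inner_le {x : H} (hS : MeasurableSet S) (hx : x ∈ E.subspace S) {M : ℝ}
    (hM : ∀ t ∈ S, (t : ℝ) ≤ M) : (inner ℂ (A x) x).re ≤ M * ‖x‖ ^ 2 := by
  rw [hE.re_inner_eq, ← E.scalarMeasure_real_univ, mul_comm, ← smul_eq_mul, ← integral_const]
  refine integral_mono_ae (hE x).1 (integrable_const _) ?_
  filter_upwards [E.ae_mem_of_mem_subspace hS hx] with t ht using hM t ht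

theorem le_re_inner {x : H} (hS : MeasurableSet S) (hx : x ∈ E.subspace S) {m : ℝ}
    (hm : ∀ t ∈ S, m ≤ (t : ℝ)) : m * ‖x‖ ^ 2 ≤ (inner ℂ (A x) x).re := by
  rw [hE.re_inner_eq, ← E.scalarMeasure_real_univ, mul_comm, ← smul_eq_mul, ← integral_const]
  refine integral_mono_ae (integrable_const _) (hE x).1 ?_
  filter_upwards [E.ae_mem_of_mem_subspace hS hx] with t ht using hm t ht

theorem re_inner_nonneg (x : H) : 0 ≤ (inner ℂ (A x) x).re := by
  rw [hE.re_inner_eq]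
  exact integral_nonneg fun t => t.2

/-- The integral only bounds the quadratic form on E(S)H. The compression E(S) A E(S) is a positive
operator on all of H below M, and for positive operators the order bound is a norm bound. -/
theorem norm_map_le {x : H} (hS : MeasurableSet S) (hx : x ∈ E.subspace S) {M : ℝ}
    (h0 : 0 ≤ M) (hM : ∀ t ∈ S, (t : ℝ) ≤ M) : ‖A x‖ ≤ M * ‖x‖ := by
  have hQ : ∀ y, inner ℂ ((E.proj S * A * E.proj S) y) y =
      inner ℂ (A (E.proj S y)) (E.proj S y) := fun y => E.inner_proj_left S _ _
  have hQs : IsSelfAdjoint (E.proj S * A * E.proj S) := by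
    rw [ContinuousLinearMap.isSelfAdjoint_iff_isSymmetric]
    intro y z
    change inner ℂ (E.proj S (A (E.proj S y))) z = inner ℂ y (E.proj S (A (E.proj S z)))
    rw [E.inner_proj_left, hE.inner_left, E.inner_proj_left]
  have hQ0 : 0 ≤ E.proj S * A * E.proj S := by
    rw [ContinuousLinearMap.nonneg_iff_isPositive, ContinuousLinearMap.isPositive_def']
    refine ⟨hQs, fun y => ?_⟩
    change 0 ≤ (inner ℂ ((E.proj S * A * E.proj S) y) y).re
    rw [hQ]
    exact hE.re_inner_nonneg _
  have hQM : E.proj S * A * E.proj S ≤ algebraMap ℝ (H →L[ℂ] H) M := by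
    rw [ContinuousLinearMap.le_def, ContinuousLinearMap.isPositive_def']
    refine ⟨(IsSelfAdjoint.algebraMap _ (.all M)).sub hQs, fun y => ?_⟩
    change 0 ≤ (inner ℂ ((algebraMap ℝ (H →L[ℂ] H) M - E.proj S * A * E.proj S) y) y).re
    have h1 : (algebraMap ℝ (H →L[ℂ] H) M) y = (M : ℂ) • y := by
      rw [Algebra.algebraMap_eq_smul_one, smul_apply, one_apply_eq_self, Complex.coe_smul]
    rw [sub_apply, inner_sub_left, Complex.sub_re, hQ, h1, inner_smul_left, Complex.conj_ofReal,
      Complex.re_ofReal_mul, show (inner ℂ y y).re = ‖y‖ ^ 2 from inner_self_eq_norm_sq (𝕜 := ℂ) y,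
      sub_nonneg]
    refine (hE.re_inner_le hS (E.proj_mem_subspace S y) hM).trans ?_
    have := E.norm_proj_le S y
    gcongr
  have hn : ‖E.proj S * A * E.proj S‖ ≤ M :=
    (CStarAlgebra.norm_le_iff_le_algebraMap _ h0 hQ0).2 hQM
  have hx' := E.mem_subspace_iff.1 hx
  calc ‖A x‖ = ‖(E.proj S * A * E.proj S) x‖ := by
        change ‖A x‖ = ‖E.proj S (A (E.proj S x))‖
        rw [hx', hE.proj_map hS, hx']
    _ ≤ M * ‖x‖ := ContinuousLinearMap.le_of_opNorm_le _ hn x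

theorem le_norm_map {x : H} (hS : MeasurableSet S) (hx : x ∈ E.subspace S) {m : ℝ}
    (hm : ∀ t ∈ S, m ≤ (t : ℝ)) : m * ‖x‖ ≤ ‖A x‖ := by
  rcases (norm_nonneg x).eq_or_lt with h0 | h0
  · rw [← h0, mul_zero]; positivity
  · refine le_of_mul_le_mul_right ?_ h0
    calc m * ‖x‖ * ‖x‖ = m * ‖x‖ ^ 2 := by ring
      _ ≤ (inner ℂ (A x) x).re := hE.le_re_inner hS hx hm
      _ ≤ ‖A x‖ * ‖x‖ := re_inner_le_norm (𝕜 := ℂ) _ _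

/-- The integral of t - a against the scalar measure is ⟨Ax, x⟩ - a‖x‖² = 0. An integrand of strict
constant sign then forces the measure, whose mass is ‖x‖², to be zero. -/
theorem eq_zero_of_map_eq_smul {x : H} {a : ℝ≥0} (hx : A x = (a : ℂ) • x)
    (h : (∀ᵐ t ∂(E.scalarMeasure x), a < t) ∨ ∀ᵐ t ∂(E.scalarMeasure x), t < a) : x = 0 := by
  have h0 : ∫ t : ℝ≥0, ((t : ℝ) - a) ∂(E.scalarMeasure x) = 0 := by
    rw [integral_sub (hE x).1 (integrable_const _), ← hE.re_inner_eq, integral_const,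
      E.scalarMeasure_real_univ, hx, inner_smul_left]
    have h1 : (inner ℂ x x).re = ‖x‖ ^ 2 := inner_self_eq_norm_sq (𝕜 := ℂ) x
    have h2 : (starRingEnd ℂ) ((a : ℝ≥0) : ℂ) = ((a : ℝ) : ℂ) := Complex.conj_ofReal _
    rw [h2, Complex.re_ofReal_mul, h1, smul_eq_mul]
    ring
  have hint : Integrable (fun t : ℝ≥0 => ((t : ℝ) - a)) (E.scalarMeasure x) :=
    (hE x).1.sub (integrable_const _)
  have hF : ∀ᵐ t ∂(E.scalarMeasure x), False := by
    rcases h with h | h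
    · have := (integral_eq_zero_iff_of_nonneg_ae
        (h.mono fun t ht => sub_nonneg.2 (NNReal.coe_le_coe.2 ht.le)) hint).1 h0
      filter_upwards [h, this] with t ht ht'
      exact ht.ne' (NNReal.coe_injective (sub_eq_zero.1 ht'))
    · have h0' : ∫ t : ℝ≥0, ((a : ℝ) - t) ∂(E.scalarMeasure x) = 0 := by
        rw [← neg_eq_zero, ← integral_neg]
        simpa using h0
      have := (integral_eq_zero_iff_of_nonneg_ae
        (h.mono fun t ht => sub_nonneg.2 (NNReal.coe_le_coe.2 ht.le))
        ((integrable_const _).sub (hE x).1)).1 h0'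
      filter_upwards [h, this] with t ht ht'
      exact ht.ne' (NNReal.coe_injective (sub_eq_zero.1 ht'))
  have hμ : E.scalarMeasure x = 0 := by
    rw [← ae_eq_bot]
    exact Filter.eventually_false_iff_eq_bot.1 hF
  have := E.scalarMeasure_real_univ x
  rw [hμ] at this
  simpa using this.symm

/-- An eigenvector lies in the spectral subspace of its eigenvalue. -/
theorem proj_singleton_of_map_eq_smul {x : H} {a : ℝ≥0} (hx : A x = (a : ℂ) • x) :
    E.proj {a} x = x := by
  -- The components of x above and below a are again eigenvectors for a, hence zero; only the
  -- component at a survives.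
  have hS : ∀ {S : Set ℝ≥0}, MeasurableSet S → A (E.proj S x) = (a : ℂ) • E.proj S x :=
    fun hS => by rw [← hE.proj_map hS, hx, map_smul]
  have h1 : E.proj (Ioi a) x = 0 := hE.eq_zero_of_map_eq_smul (hS measurableSet_Ioi)
    (.inl (E.ae_mem_of_mem_subspace measurableSet_Ioi (E.proj_mem_subspace _ x)))
  have h2 : E.proj (Iio a) x = 0 := hE.eq_zero_of_map_eq_smul (hS measurableSet_Iio)
    (.inr (E.ae_mem_of_mem_subspace measurableSet_Iio (E.proj_mem_subspace _ x)))
  have h3 : E.proj (Iic a) x = E.proj (Iio a) x + E.proj {a} x := by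
    rw [← Iio_union_right,
      E.proj_union measurableSet_Iio (measurableSet_singleton a) (by simp)]
  have h4 : x = E.proj (Iic a) x + E.proj (Ioi a) x := by
    rw [← E.proj_union measurableSet_Iic measurableSet_Ioi
      (disjoint_left.2 fun t (h : t ≤ a) (h' : a < t) => h.not_gt h'), Iic_union_Ioi, E.proj_univ]
    rfl
  rw [h1, h3, h2, zero_add, add_zero] at h4
  exact h4.symm

end IsDecompositionOf

end SpectralMeasure

/-! ### Decomposition of the space along a countable partition -/

namespace SpectralMeasure

open Cardinal

section Partition

variable {H : Type*} [NormedAddCommGroup H] [InnerProductSpace ℂ H] [CompleteSpace H]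
  (E : SpectralMeasure H) {J : Type*} {S : J → Set ℝ≥0}

theorem orthogonalFamily_subspace (hS : ∀ j, MeasurableSet (S j))
    (hd : Pairwise (fun i j => Disjoint (S i) (S j))) :
    OrthogonalFamily ℂ (fun j => E.subspace (S j)) fun j => (E.subspace (S j)).subtypeₗᵢ := by
  intro i j hij x y
  change inner ℂ (x : H) (y : H) = 0
  rw [← E.mem_subspace_iff.1 x.2, ← E.mem_subspace_iff.1 y.2, E.inner_proj_left,
    E.proj_proj_of_disjoint (hS i) (hS j) (hd hij), inner_zero_right]

theorem orthonormal_sigma (hS : ∀ j, MeasurableSet (S j))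
    (hd : Pairwise (fun i j => Disjoint (S i) (S j))) {ι : J → Type*}
    (b : ∀ j, HilbertBasis (ι j) ℂ (E.subspace (S j))) :
    Orthonormal ℂ (fun p : Σ j, ι j => (b p.1 p.2 : H)) :=
  (E.orthogonalFamily_subspace hS hd).orthonormal_sigma_orthonormal fun j => (b j).orthonormal

theorem eq_zero_of_inner_sigma [Countable J] (hS : ∀ j, MeasurableSet (S j))
    (hd : Pairwise (fun i j => Disjoint (S i) (S j))) {ι : J → Type*}
    (b : ∀ j, HilbertBasis (ι j) ℂ (E.subspace (S j))) {x : H} (hx : x ∈ E.subspace (⋃ j, S j))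
    (h : ∀ p : Σ j, ι j, inner ℂ (b p.1 p.2 : H) x = 0) : x = 0 := by
  have hP : ∀ j, E.proj (S j) x = 0 := by
    intro j
    have h0 : (⟨E.proj (S j) x, E.proj_mem_subspace _ x⟩ : E.subspace (S j)) = 0 := by
      refine (b j).eq_zero_of_forall_inner fun i => ?_
      change inner ℂ (b j i : H) (E.proj (S j) x) = 0
      rw [← E.inner_proj_left, E.mem_subspace_iff.1 (b j i).2]
      exact h ⟨j, i⟩
    exact congrArg Subtype.val h0
  have hsum := E.hasSum_proj_iUnion hS hd x
  rw [E.mem_subspace_iff.1 hx] at hsum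
  simp only [hP] at hsum
  exact hsum.unique hasSum_zero

variable [Countable J] (hS : ∀ j, MeasurableSet (S j)) (hd : Pairwise (fun i j => Disjoint (S i) (S j)))
  (hU : ⋃ j, S j = Set.univ)
include hS hd hU

theorem hasSum_proj_partition (x : H) : HasSum (fun j => E.proj (S j) x) x := by
  have h := E.hasSum_proj_iUnion hS hd x
  rwa [hU, E.proj_univ] at h

theorem ext_of_proj_eq {x y : H} (h : ∀ j, E.proj (S j) x = E.proj (S j) y) : x = y := by
  have hx := E.hasSum_proj_partition hS hd hU x
  simp only [h] at hx
  exact hx.unique (E.hasSum_proj_partition hS hd hU y)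

theorem hasSum_norm_proj_sq (x : H) : HasSum (fun j => ‖E.proj (S j) x‖ ^ 2) (‖x‖ ^ 2) := by
  have h := Complex.reCLM.hasSum ((innerSL ℂ x).hasSum (E.hasSum_proj_partition hS hd hU x))
  convert h using 1
  · ext j
    exact (E.re_inner_proj (S j) x).symm
  · exact (inner_self_eq_norm_sq (𝕜 := ℂ) x).symm

/-- Pythagoras over the cells: a comparison on each cell with one common constant is a comparison of
the full norms. -/
theorem norm_le_mul_norm_of_proj {H' : Type*} [NormedAddCommGroup H'] [InnerProductSpace ℂ H']
    [CompleteSpace H'] (E' : SpectralMeasure H') {x : H} {y : H'} {C : ℝ} (hC : 0 ≤ C)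
    (h : ∀ j, ‖E'.proj (S j) y‖ ≤ C * ‖E.proj (S j) x‖) : ‖y‖ ≤ C * ‖x‖ := by
  rw [← sq_le_sq₀ (norm_nonneg _) (by positivity), mul_pow]
  refine hasSum_le (fun j => ?_) (E'.hasSum_norm_proj_sq hS hd hU y)
    ((E.hasSum_norm_proj_sq hS hd hU x).mul_left (C ^ 2))
  rw [← mul_pow]
  have := h j
  gcongr

theorem exists_hilbertBasis_sigma {ι : J → Type*}
    (b : ∀ j, HilbertBasis (ι j) ℂ (E.subspace (S j))) :
    ∃ c : HilbertBasis (Σ j, ι j) ℂ H, ∀ p, c p = b p.1 p.2 := by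
  refine ⟨HilbertBasis.mkOfOrthogonalEqBot (E.orthonormal_sigma hS hd b) ?_, fun p => ?_⟩
  · rw [Submodule.eq_bot_iff]
    intro x hx
    refine E.eq_zero_of_inner_sigma hS hd b ?_ fun p => hx _ (Submodule.subset_span ⟨p, rfl⟩)
    rw [hU, E.mem_subspace_iff, E.proj_univ]
    rfl
  · rw [HilbertBasis.coe_mkOfOrthogonalEqBot]

end Partition

theorem hilbertDim_subspace_iUnion {H : Type u₁} [NormedAddCommGroup H] [InnerProductSpace ℂ H]
    [CompleteSpace H] (E : SpectralMeasure H) {J : Type} [Countable J] {S : J → Set ℝ≥0}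
    (hS : ∀ j, MeasurableSet (S j)) (hd : Pairwise (fun i j => Disjoint (S i) (S j))) :
    hilbertDim (E.subspace (⋃ j, S j)) = Cardinal.sum fun j => hilbertDim (E.subspace (S j)) := by
  choose ι b hb using fun j => exists_hilbertBasis_mk_eq_hilbertDim (E.subspace (S j))
  rw [← (E.orthonormal_sigma hS hd b).mk_eq_hilbertDim (K := E.subspace (⋃ j, S j)) ?_ ?_, mk_sigma]
  · simp only [hb]
  · intro p
    have hp := E.mem_subspace_iff.1 (b p.1 p.2).2
    rw [E.mem_subspace_iff, ← hp, E.proj_proj (.iUnion hS) (hS _),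
      inter_eq_self_of_subset_right (subset_iUnion S p.1)]
  · exact fun x hx h => E.eq_zero_of_inner_sigma hS hd b hx h

theorem _root_.Cardinal.sum_bool (f : Bool → Cardinal.{u₁}) :
    Cardinal.sum f = f true + f false := by
  let e : (Σ b, (f b).out) ≃ (f true).out ⊕ (f false).out :=
    { toFun := fun p => match p with
        | ⟨true, x⟩ => .inl x
        | ⟨false, x⟩ => .inr x
      invFun := Sum.elim (fun x => ⟨true, x⟩) fun x => ⟨false, x⟩
      left_inv := by rintro ⟨_ | _, x⟩ <;> rfl
      right_inv := by rintro (x | x) <;> rfl }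
  have h := e.cardinal_eq
  simpa using h

theorem hilbertDim_subspace_union {H : Type u₁} [NormedAddCommGroup H] [InnerProductSpace ℂ H]
    [CompleteSpace H] (E : SpectralMeasure H) {S S' : Set ℝ≥0} (hS : MeasurableSet S)
    (hS' : MeasurableSet S') (h : Disjoint S S') :
    hilbertDim (E.subspace (S ∪ S')) =
      hilbertDim (E.subspace S) + hilbertDim (E.subspace S') := by
  have hsum := E.hilbertDim_subspace_iUnion (S := fun b : Bool => cond b S S')
    (by rintro (_ | _) <;> assumption)
    (by rintro (_ | _) (_ | _) hij <;> first | exact absurd rfl hij | exact h | exact h.symm)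
  rw [← union_eq_iUnion] at hsum
  rw [hsum, sum_bool]
  rfl

/-- Spectral measures that give the pieces of a partition the same dimensions are intertwined on
the partition by a unitary. -/
theorem exists_unitary_intertwining
    {H₁ : Type u₁} [NormedAddCommGroup H₁] [InnerProductSpace ℂ H₁] [CompleteSpace H₁]
    {H₂ : Type u₂} [NormedAddCommGroup H₂] [InnerProductSpace ℂ H₂] [CompleteSpace H₂]
    (E₁ : SpectralMeasure H₁) (E₂ : SpectralMeasure H₂) {J : Type} [Countable J]
    {S : J → Set ℝ≥0} (hS : ∀ j, MeasurableSet (S j))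
    (hd : Pairwise (fun i j => Disjoint (S i) (S j))) (hU : ⋃ j, S j = Set.univ)
    (h : ∀ j, lift.{u₂} (hilbertDim (E₁.subspace (S j))) =
      lift.{u₁} (hilbertDim (E₂.subspace (S j)))) :
    ∃ W : H₁ ≃ₗᵢ[ℂ] H₂, ∀ j x, E₂.proj (S j) (W x) = W (E₁.proj (S j) x) := by
  choose ι₁ b₁ hb₁ using fun j => exists_hilbertBasis_mk_eq_hilbertDim (E₁.subspace (S j))
  choose ι₂ b₂ hb₂ using fun j => exists_hilbertBasis_mk_eq_hilbertDim (E₂.subspace (S j))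
  have he : ∀ j, Nonempty (ι₁ j ≃ ι₂ j) := fun j =>
    lift_mk_eq'.1 (by rw [hb₁, hb₂, h j])
  obtain ⟨c₁, hc₁⟩ := E₁.exists_hilbertBasis_sigma hS hd hU b₁
  obtain ⟨c₂, hc₂⟩ := E₂.exists_hilbertBasis_sigma hS hd hU b₂
  obtain ⟨W, hW⟩ := c₁.exists_linearIsometryEquiv c₂ (.sigmaCongrRight fun j => (he j).some)
  refine ⟨W, fun j => ?_⟩
  have hext : E₂.proj (S j) ∘L W.toContinuousLinearEquiv.toContinuousLinearMap =
      W.toContinuousLinearEquiv.toContinuousLinearMap ∘L E₁.proj (S j) := by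
    -- Basis vectors suffice. Since W maps basis vectors of a cell to basis vectors of the same
    -- cell, each projection either fixes both vectors or kills both.
    refine ContinuousLinearMap.ext_on
      (Submodule.dense_iff_topologicalClosure_eq_top.2 c₁.dense_span) ?_
    rintro _ ⟨p, rfl⟩
    change E₂.proj (S j) (W (c₁ p)) = W (E₁.proj (S j) (c₁ p))
    have h₁ : c₁ p ∈ E₁.subspace (S p.1) := by rw [hc₁]; exact (b₁ p.1 p.2).2
    have h₂ : W (c₁ p) ∈ E₂.subspace (S p.1) := by rw [hW, hc₂]; exact (b₂ p.1 _).2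
    rw [E₁.mem_subspace_iff] at h₁
    rw [E₂.mem_subspace_iff] at h₂
    rcases eq_or_ne j p.1 with rfl | hj
    · rw [h₁, h₂]
    · rw [← h₂, E₂.proj_proj_of_disjoint (hS j) (hS p.1) (hd hj), ← h₁,
        E₁.proj_proj_of_disjoint (hS j) (hS p.1) (hd hj), map_zero]
  exact fun x => congrArg (fun P : H₁ →L[ℂ] H₂ => P x) hext

end SpectralMeasure

/-! ### Replacing an operator by a constant on each cell -/

namespace SpectralMeasure

section Weights

variable {H : Type*} [NormedAddCommGroup H] [InnerProductSpace ℂ H] [CompleteSpace H]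
  {E : SpectralMeasure H} {A : H →L[ℂ] H} (hE : E.IsDecompositionOf A)
  {J : Type*} {S : J → Set ℝ≥0} (hS : ∀ j, MeasurableSet (S j))
  {a : J → ℝ≥0} {K : ℝ} (hK : 1 ≤ K)

include hE hS hK in
theorem IsDecompositionOf.norm_proj_map_le (h : ∀ j, ∀ t ∈ S j, (t : ℝ) ≤ K * a j) (j : J) (x : H) :
    ‖E.proj (S j) (A x)‖ ≤ K * (a j * ‖E.proj (S j) x‖) := by
  rw [hE.proj_map (hS j), ← mul_assoc]
  exact hE.norm_map_le (hS j) (E.proj_mem_subspace _ x) (by positivity) (h j)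

include hE hS hK in
theorem IsDecompositionOf.le_norm_proj_map (h : ∀ j, ∀ t ∈ S j, (a j : ℝ) ≤ K * t) (j : J) (x : H) :
    a j * ‖E.proj (S j) x‖ ≤ K * ‖E.proj (S j) (A x)‖ := by
  have h1 := hE.le_norm_map (hS j) (E.proj_mem_subspace _ x) (m := a j / K)
    fun t ht => (div_le_iff₀' (by positivity)).2 (h j t ht)
  rw [hE.proj_map (hS j)]
  rwa [div_mul_eq_mul_div, div_le_iff₀' (by positivity)] at h1

variable [Countable J]

/-- Operators whose spectral measures are intertwined on a fine enough partition have comparable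
norms. -/
theorem norm_map_le_of_intertwining (hd : Pairwise (fun i j => Disjoint (S i) (S j)))
    (hU : ⋃ j, S j = univ) (hE : E.IsDecompositionOf A) (hS : ∀ j, MeasurableSet (S j))
    (hK : 1 ≤ K) (h : ∀ j, ∀ t ∈ S j, (t : ℝ) ≤ K * a j ∧ (a j : ℝ) ≤ K * t)
    {H' : Type*} [NormedAddCommGroup H'] [InnerProductSpace ℂ H'] [CompleteSpace H']
    {E' : SpectralMeasure H'} {A' : H' →L[ℂ] H'} (hE' : E'.IsDecompositionOf A') {x : H} {y : H'}
    (hxy : ∀ j, ‖E'.proj (S j) y‖ = ‖E.proj (S j) x‖) : ‖A' y‖ ≤ K * K * ‖A x‖ := by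
  refine E.norm_le_mul_norm_of_proj hS hd hU E' (by positivity) fun j => ?_
  calc ‖E'.proj (S j) (A' y)‖ ≤ K * (a j * ‖E'.proj (S j) y‖) :=
        hE'.norm_proj_map_le hS hK (fun j t ht => (h j t ht).1) j y
    _ ≤ K * (K * ‖E.proj (S j) (A x)‖) := by
        rw [hxy]
        have := hE.le_norm_proj_map hS hK (fun j t ht => (h j t ht).2) j x
        gcongr
    _ = K * K * ‖E.proj (S j) (A x)‖ := by ring

/-- The diagonal operator `∑ a_j E(S_j)`. -/
theorem IsDecompositionOf.exists_diagonal (hd : Pairwise (fun i j => Disjoint (S i) (S j)))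
    (hU : ⋃ j, S j = univ) (hE : E.IsDecompositionOf A) (hS : ∀ j, MeasurableSet (S j))
    (hK : 1 ≤ K) (h : ∀ j, ∀ t ∈ S j, (a j : ℝ) ≤ K * t) :
    ∃ D : H →L[ℂ] H, 0 ≤ D ∧ ∀ j x, E.proj (S j) (D x) = (a j : ℂ) • E.proj (S j) x := by
  have hle := hE.le_norm_proj_map hS hK h
  have hnorm : ∀ j x, ‖(a j : ℂ) • E.proj (S j) x‖ = a j * ‖E.proj (S j) x‖ := by
    intro j x
    rw [norm_smul, Complex.norm_real, NNReal.norm_eq]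
  have hsumm : ∀ x, Summable fun j => (a j : ℂ) • E.proj (S j) x := by
    intro x
    -- The weights a_j may be unbounded, for instance on empty cells. Convergence comes from
    -- a_j‖E(S_j)x‖ ≤ K‖E(S_j)Ax‖, whose right sides are square summable; the same bound makes D
    -- bounded.
    refine ((E.orthogonalFamily_subspace hS hd).summable_iff_norm_sq_summable fun j =>
      ⟨(a j : ℂ) • E.proj (S j) x, Submodule.smul_mem _ _ (E.proj_mem_subspace _ x)⟩).2 ?_
    refine Summable.of_nonneg_of_le (fun j => by positivity) (fun j => ?_)
      ((E.hasSum_norm_proj_sq hS hd hU (A x)).summable.mul_left (K ^ 2))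
    rw [← mul_pow]
    refine pow_le_pow_left₀ (norm_nonneg _) ?_ 2
    change ‖(a j : ℂ) • E.proj (S j) x‖ ≤ _
    rw [hnorm]
    exact hle j x
  let D₀ : H →ₗ[ℂ] H :=
    { toFun := fun x => ∑' j, (a j : ℂ) • E.proj (S j) x
      map_add' := fun x y => by
        rw [← (hsumm x).tsum_add (hsumm y)]
        simp
      map_smul' := fun c x => by
        rw [RingHom.id_apply, ← (hsumm x).tsum_const_smul c]
        simp only [map_smul, smul_comm c] }
  have hD₀ : ∀ x, HasSum (fun j => (a j : ℂ) • E.proj (S j) x) (D₀ x) := fun x => (hsumm x).hasSum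
  have hproj : ∀ j x, E.proj (S j) (D₀ x) = (a j : ℂ) • E.proj (S j) x := by
    intro j x
    refine ((E.proj (S j)).hasSum (hD₀ x)).unique ?_
    convert hasSum_single j ?_ using 1
    · rw [map_smul, E.proj_proj_self]
    · intro i hi
      rw [map_smul, E.proj_proj_of_disjoint (hS j) (hS i) (hd hi.symm), smul_zero]
  have hbound : ∀ x, ‖D₀ x‖ ≤ K * ‖A x‖ := fun x =>
    E.norm_le_mul_norm_of_proj hS hd hU E (by positivity) fun j => by
      rw [hproj, hnorm]
      exact hle j x
  let D : H →L[ℂ] H := D₀.mkContinuousOfExistsBound ⟨K * ‖A‖, fun x => by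
    rw [mul_assoc]
    exact (hbound x).trans (by gcongr; exact A.le_opNorm x)⟩
  have hinner : ∀ x, HasSum (fun j => ((a j * ‖E.proj (S j) x‖ ^ 2 : ℝ) : ℂ)) (inner ℂ x (D x)) := by
    intro x
    have hterm : (fun j => ((a j * ‖E.proj (S j) x‖ ^ 2 : ℝ) : ℂ)) =
        fun j => innerSL ℂ x ((a j : ℂ) • E.proj (S j) x) := by
      funext j
      rw [innerSL_apply_apply, inner_smul_right, Complex.ofReal_mul]
      congr 1
      rw [← E.proj_proj_self, ← E.inner_proj_left, inner_self_eq_norm_sq_to_K, E.proj_proj_self]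
      simp
    rw [hterm]
    exact (innerSL ℂ x).hasSum (hD₀ x)
  refine ⟨D, ?_, hproj⟩
  rw [ContinuousLinearMap.nonneg_iff_isPositive, ContinuousLinearMap.isPositive_iff_complex]
  intro x
  have hre := Complex.reCLM.hasSum (hinner x)
  have him := Complex.imCLM.hasSum (hinner x)
  simp only [Complex.reCLM_apply, Complex.ofReal_re, Complex.imCLM_apply,
    Complex.ofReal_im] at hre him
  have him0 : (inner ℂ x (D x)).im = 0 := him.unique hasSum_zero
  have hre0 : 0 ≤ (inner ℂ x (D x)).re := hre.nonneg fun j => by positivity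
  have hflip : inner ℂ (D x) x = inner ℂ x (D x) := by
    rw [← inner_conj_symm]
    exact Complex.conj_eq_iff_im.2 him0
  rw [hflip]
  exact ⟨Complex.ext rfl him0.symm, hre0⟩

/-- The spectral measure of the diagonal operator is the image of the spectral measure that defines
it. -/
theorem IsDecompositionOf.proj_diagonal (hd : Pairwise (fun i j => Disjoint (S i) (S j)))
    (hU : ⋃ j, S j = univ) (hS : ∀ j, MeasurableSet (S j)) {D : H →L[ℂ] H}
    (hD : ∀ j x, E.proj (S j) (D x) = (a j : ℂ) • E.proj (S j) x)
    {E' : SpectralMeasure H} (hE' : E'.IsDecompositionOf D) {B : Set ℝ≥0} (hB : MeasurableSet B) :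
    E'.proj B = E.proj (⋃ j : {j // a j ∈ B}, S j) := by
  classical
  -- Vectors of E(S_j)H are eigenvectors of D for a_j, so E'({a_j}) fixes them and E'(B) fixes or
  -- kills them according to whether a_j lies in B. Several cells may share the same a_j.
  have heig : ∀ j x, D (E.proj (S j) x) = (a j : ℂ) • E.proj (S j) x := by
    intro j x
    refine E.ext_of_proj_eq hS hd hU fun i => ?_
    rw [hD, map_smul]
    rcases eq_or_ne i j with rfl | hij
    · rfl
    · rw [E.proj_proj_of_disjoint (hS i) (hS j) (hd hij), smul_zero, smul_zero]
  have hpiece : ∀ j x, E'.proj B (E.proj (S j) x) =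
      {j | a j ∈ B}.indicator (fun j => E.proj (S j) x) j := by
    intro j x
    rw [← hE'.proj_singleton_of_map_eq_smul (heig j x),
      E'.proj_proj hB (measurableSet_singleton _)]
    by_cases hj : a j ∈ B
    · rw [inter_eq_self_of_subset_right (singleton_subset_iff.2 hj),
        indicator_of_mem (show j ∈ {j | a j ∈ B} from hj),
        hE'.proj_singleton_of_map_eq_smul (heig j x)]
    · rw [inter_singleton_eq_empty.2 hj, E'.proj_empty,
        indicator_of_notMem (show j ∉ {j | a j ∈ B} from hj)]
      rfl
  ext x
  have h1 := (E'.proj B).hasSum (E.hasSum_proj_partition hS hd hU x)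
  have h2 := E.hasSum_proj_iUnion (S := fun j : {j // a j ∈ B} => S j) (fun j => hS j)
    (fun i j hij => hd fun h => hij (Subtype.ext h)) x
  have h3 := (hasSum_subtype_iff_indicator (f := fun j => E.proj (S j) x)
    (s := {j | a j ∈ B})).1 h2
  simp only [hpiece] at h1
  exact h1.unique h3

end Weights

end SpectralMeasure

/-- The completeness instance depends on the subspace, so equal subspaces are exchanged here by
substitution. -/
theorem hilbertDim_congr {H : Type u₁} [NormedAddCommGroup H] [InnerProductSpace ℂ H]
    {K L : Submodule ℂ H} [CompleteSpace K] [CompleteSpace L] (h : K = L) :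
    hilbertDim K = hilbertDim L := by
  subst h
  rfl

/-! ### The positive operator √(T*T) and right factors -/

section AbsOperator

variable {H : Type u₁} [NormedAddCommGroup H] [InnerProductSpace ℂ H] [CompleteSpace H]
  {G : Type v₁} [NormedAddCommGroup G] [InnerProductSpace ℂ G] [CompleteSpace G]

theorem adjoint_comp_self_nonneg (T : H →L[ℂ] G) : 0 ≤ ContinuousLinearMap.adjoint T ∘L T :=
  (ContinuousLinearMap.nonneg_iff_isPositive _).2 (ContinuousLinearMap.isPositive_adjoint_comp_self T)

theorem absOperator_nonneg (T : H →L[ℂ] G) : 0 ≤ absOperator T := CFC.sqrt_nonneg _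

theorem absOperator_mul_self (T : H →L[ℂ] G) :
    absOperator T * absOperator T = ContinuousLinearMap.adjoint T ∘L T :=
  CFC.sqrt_mul_sqrt_self _ (adjoint_comp_self_nonneg T)

theorem norm_absOperator (T : H →L[ℂ] G) (x : H) : ‖absOperator T x‖ = ‖T x‖ := by
  have hs : ∀ y z, inner ℂ (absOperator T y) z = inner ℂ y (absOperator T z) :=
    ContinuousLinearMap.isSelfAdjoint_iff_isSymmetric.1 (.of_nonneg (absOperator_nonneg T))
  rw [← sq_eq_sq₀ (norm_nonneg _) (norm_nonneg _), ← inner_self_eq_norm_sq (𝕜 := ℂ),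
    ← inner_self_eq_norm_sq (𝕜 := ℂ), hs, ← mul_apply_eq_comp, absOperator_mul_self,
    ContinuousLinearMap.comp_apply, ContinuousLinearMap.adjoint_inner_right]

theorem exists_dimSpectralMeasure_eq (T : H →L[ℂ] G) :
    ∃ E : SpectralMeasure H, E.IsDecompositionOf (absOperator T) ∧
      ∀ S, dimSpectralMeasure T S = hilbertDim (E.subspace S) := by
  have h := exists_isDecompositionOf (absOperator T) (absOperator_nonneg T)
  exact ⟨h.choose, h.choose_spec, fun S => dif_pos h⟩

/-- Self-adjoint operators with comparable norms differ by an invertible factor on the right. -/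
theorem exists_equiv_factor {A D : H →L[ℂ] H} (hA : IsSelfAdjoint A) (hD : IsSelfAdjoint D)
    {C : ℝ} (h₁ : ∀ x, ‖A x‖ ≤ C * ‖D x‖) (h₂ : ∀ x, ‖D x‖ ≤ C * ‖A x‖) :
    ∃ R : H ≃L[ℂ] H, ∀ x, A (R x) = D x := by
  have hker : LinearMap.ker (D : H →ₗ[ℂ] H) = LinearMap.ker (A : H →ₗ[ℂ] H) := by
    ext x
    constructor
    · intro (hx : D x = 0)
      exact norm_le_zero_iff.1 ((h₁ x).trans (by simp [hx]))
    · intro (hx : A x = 0)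
      exact norm_le_zero_iff.1 ((h₂ x).trans (by simp [hx]))
  have hran : (LinearMap.range (D : H →ₗ[ℂ] H))ᗮ = (LinearMap.range (A : H →ₗ[ℂ] H))ᗮ := by
    have hA' : ContinuousLinearMap.adjoint A = A := hA
    have hD' : ContinuousLinearMap.adjoint D = D := hD
    rw [ContinuousLinearMap.orthogonal_range, ContinuousLinearMap.orthogonal_range, hA', hD', hker]
  -- Comparable norms give a factor on the left, A = V D. Taking adjoints moves it to the right, A =
  -- D V*, so the inverse of V* is the required R.
  obtain ⟨V, hV⟩ := exists_equiv_of_norm_le (T₁ := D) (T₂ := A) (.refl ℂ H) h₁ h₂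
    (LinearIsometryEquiv.ofEq _ _ hran)
  have hAV : A = V.toContinuousLinearMap * D := by ext x; exact hV x
  have hVs : V.toContinuousLinearMap * V.symm.toContinuousLinearMap = 1 := by ext x; simp
  have hsV : V.symm.toContinuousLinearMap * V.toContinuousLinearMap = 1 := by ext x; simp
  have hVs' : star V.symm.toContinuousLinearMap * star V.toContinuousLinearMap = 1 := by
    rw [← star_mul, hVs, star_one]
  have hsV' : star V.toContinuousLinearMap * star V.symm.toContinuousLinearMap = 1 := by
    rw [← star_mul, hsV, star_one]
  refine ⟨ContinuousLinearEquiv.equivOfInverse (star V.symm.toContinuousLinearMap)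
    (star V.toContinuousLinearMap) (fun x => congrArg (fun P : H →L[ℂ] H => P x) hsV')
    (fun x => congrArg (fun P : H →L[ℂ] H => P x) hVs'), fun x => ?_⟩
  have h : A * star V.symm.toContinuousLinearMap = D := by
    rw [← hA.star_eq, hAV, star_mul, mul_assoc, hsV', mul_one, hD.star_eq]
  exact congrArg (fun P : H →L[ℂ] H => P x) h

/-- (TR)*(TR) = R*|T|²R = (|T|R)*(|T|R) = D², and D is the only positive square root of D². -/
theorem absOperator_comp_of_absOperator_mul_eq {T : H →L[ℂ] G} {R D : H →L[ℂ] H}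
    (hD : 0 ≤ D) (h : absOperator T * R = D) : absOperator (T ∘L R) = D := by
  have hs : IsSelfAdjoint (absOperator T) := .of_nonneg (absOperator_nonneg T)
  have hDs : IsSelfAdjoint D := .of_nonneg hD
  have hsq : ContinuousLinearMap.adjoint (T ∘L R) ∘L (T ∘L R) = D * D := by
    calc ContinuousLinearMap.adjoint (T ∘L R) ∘L (T ∘L R)
        = star R * (ContinuousLinearMap.adjoint T ∘L T) * R := by
          rw [ContinuousLinearMap.adjoint_comp]; rfl
      _ = star R * star (absOperator T) * (absOperator T * R) := by
          rw [← absOperator_mul_self, hs.star_eq]; noncomm_ring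
      _ = D * D := by rw [← star_mul, h, hDs.star_eq]
  rw [absOperator, hsq, CFC.sqrt_mul_self D hD]

end AbsOperator

/-! ### The cell at zero and the main theorem -/

/-- The comparison of cells and points, with the cell `{0}` and the point `0` added. -/
theorem forall_mem_le_of_log_bound {ι : Type*} {S : ι → Set ℝ≥0} {a : ι → ℝ≥0}
    (hS : ∀ k, 0 ∉ S k) (ha : ∀ k, 0 < a k) {K : ℝ≥0}
    (h : ∀ k, ∀ y ∈ S k ∪ {a k}, ∀ z ∈ S k ∪ {a k}, K⁻¹ ≤ y / z ∧ y / z ≤ K) :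
    ∀ j, ∀ t ∈ Option.elim j {0} S,
      (t : ℝ) ≤ K * (Option.elim j 0 a : ℝ≥0) ∧ ((Option.elim j 0 a : ℝ≥0) : ℝ) ≤ K * t := by
  rintro (_ | k) t ht
  · have ht : t = 0 := ht
    simp [ht]
  · have ht : t ∈ S k := ht
    have ht0 : 0 < t := pos_iff_ne_zero.2 fun h0 => hS k (h0 ▸ ht)
    have h1 := (h k t (.inl ht) (a k) (.inr rfl)).2
    have h2 := (h k (a k) (.inr rfl) t (.inl ht)).2
    rw [div_le_iff₀ (ha k)] at h1
    rw [div_le_iff₀ ht0] at h2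
    exact ⟨by exact_mod_cast h1, by exact_mod_cast h2⟩

theorem mainTheorem7
    -- a countable Borel partition of `]0,∞[` and points `a k` in `]0,∞[`
    {ι : Type} [Countable ι] (S : ι → Set ℝ≥0) (a : ι → ℝ≥0)
    (hS_meas : ∀ k, MeasurableSet (S k))
    (hS_disj : Pairwise (fun j k => Disjoint (S j) (S k)))
    (hS_cover : ⋃ k, S k = Set.Ioi 0)
    (ha : ∀ k, 0 < a k)
    -- the log-diameters of `S k ∪ {a k}` are uniformly bounded
    (hlog : ∃ K : ℝ≥0, 1 < K ∧ ∀ k, ∀ y ∈ S k ∪ {a k}, ∀ z ∈ S k ∪ {a k},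
      K⁻¹ ≤ y / z ∧ y / z ≤ K)
    -- two bounded operators between complex Hilbert spaces
    {H₁ : Type u₁} [NormedAddCommGroup H₁] [InnerProductSpace ℂ H₁] [CompleteSpace H₁]
    {G₁ : Type v₁} [NormedAddCommGroup G₁] [InnerProductSpace ℂ G₁] [CompleteSpace G₁]
    {H₂ : Type u₂} [NormedAddCommGroup H₂] [InnerProductSpace ℂ H₂] [CompleteSpace H₂]
    {G₂ : Type v₂} [NormedAddCommGroup G₂] [InnerProductSpace ℂ G₂] [CompleteSpace G₂]
    (T₁ : H₁ →L[ℂ] G₁) (T₂ : H₂ →L[ℂ] G₂) :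
    -- same weights imply topological equivalence, as operators into the closures of the ranges;
    -- and of the operators themselves if the closures of the ranges have the same codimension
    ((Cardinal.lift.{u₂} (dimSpectralMeasure T₁ {0}) = Cardinal.lift.{u₁} (dimSpectralMeasure T₂ {0}) →
      (∀ k, Cardinal.lift.{u₂} (dimSpectralMeasure T₁ (S k)) =
        Cardinal.lift.{u₁} (dimSpectralMeasure T₂ (S k))) →
      TopologicallyEquivalent (toClosureRange T₁) (toClosureRange T₂) ∧
      (Cardinal.lift.{v₂} (hilbertDim (LinearMap.range (T₁ : H₁ →ₗ[ℂ] G₁))ᗮ) =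
          Cardinal.lift.{v₁} (hilbertDim (LinearMap.range (T₂ : H₂ →ₗ[ℂ] G₂))ᗮ) →
        TopologicallyEquivalent T₁ T₂))) ∧
    -- the mass of every `S k` may be transferred to `a k`
    (∃ T' : H₁ →L[ℂ] G₁, TopologicallyEquivalent T₁ T' ∧
      ∀ B : Set ℝ≥0, MeasurableSet B →
        dimSpectralMeasure T' B =
          dimSpectralMeasure T₁ (B ∩ {0}) +
            Cardinal.sum (fun k : {k : ι // a k ∈ B} => dimSpectralMeasure T₁ (S k))) := by
  obtain ⟨K, hK, hlog⟩ := hlog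
  have hS0 : ∀ k, 0 ∉ S k := fun k h0 =>
    lt_irrefl (0 : ℝ≥0) (hS_cover.subset (mem_iUnion.2 ⟨k, h0⟩))
  -- Adjoining the cell {0} with weight 0 gives a partition of all of [0,∞); the two-sided
  -- comparison there reads 0 ≤ K · 0. The kernel is thus treated like any other cell.
  let S' : Option ι → Set ℝ≥0 := fun j => j.elim {0} S
  let a' : Option ι → ℝ≥0 := fun j => j.elim 0 a
  have hS' : ∀ j, MeasurableSet (S' j) := by
    rintro (_ | k)
    exacts [measurableSet_singleton _, hS_meas k]
  have hd : Pairwise (fun i j => Disjoint (S' i) (S' j)) := by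
    rintro (_ | i) (_ | j) hij
    · exact absurd rfl hij
    · exact disjoint_singleton_left.2 (hS0 j)
    · exact disjoint_singleton_right.2 (hS0 i)
    · exact hS_disj fun h => hij (congrArg some h)
  have hU : ⋃ j, S' j = univ := by
    rw [iUnion_option]
    change {0} ∪ ⋃ k, S k = univ
    rw [hS_cover]
    ext t
    simp
  have hK1 : (1 : ℝ) ≤ K := by exact_mod_cast hK.le
  have hb : ∀ j, ∀ t ∈ S' j, (t : ℝ) ≤ K * a' j ∧ (a' j : ℝ) ≤ K * t :=
    forall_mem_le_of_log_bound hS0 ha hlog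
  obtain ⟨E₁, hE₁, hdim₁⟩ := exists_dimSpectralMeasure_eq T₁
  constructor
  · intro h0 hk
    obtain ⟨E₂, hE₂, hdim₂⟩ := exists_dimSpectralMeasure_eq T₂
    obtain ⟨W, hW⟩ := E₁.exists_unitary_intertwining E₂ hS' hd hU (by
      rintro (_ | k)
      · rwa [hdim₁, hdim₂] at h0
      · have hk := hk k
        rwa [hdim₁, hdim₂] at hk)
    have hnorm : ∀ j x, ‖E₂.proj (S' j) (W x)‖ = ‖E₁.proj (S' j) x‖ := fun j x => by
      rw [hW, W.norm_map]
    have h₁ : ∀ x, ‖T₂ (W.toContinuousLinearEquiv x)‖ ≤ K * K * ‖T₁ x‖ := fun x => by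
      rw [← norm_absOperator T₁, ← norm_absOperator T₂]
      exact SpectralMeasure.norm_map_le_of_intertwining hd hU hE₁ hS' hK1 hb hE₂ (hnorm · x)
    have h₂ : ∀ x, ‖T₁ x‖ ≤ K * K * ‖T₂ (W.toContinuousLinearEquiv x)‖ := fun x => by
      rw [← norm_absOperator T₁, ← norm_absOperator T₂]
      exact SpectralMeasure.norm_map_le_of_intertwining hd hU hE₂ hS' hK1 hb hE₁
        fun j => (hnorm j x).symm
    refine ⟨?_, fun hcodim => ?_⟩
    · obtain ⟨V, hV⟩ := exists_equiv_closure_range_of_norm_le _ h₁ h₂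
      exact ⟨_, V, hV⟩
    · obtain ⟨W'⟩ := nonempty_linearIsometryEquiv_of_hilbertDim_eq hcodim
      obtain ⟨V, hV⟩ := exists_equiv_of_norm_le _ h₁ h₂ W'
      exact ⟨_, V, hV⟩
  · obtain ⟨D, hD0, hD⟩ := hE₁.exists_diagonal hd hU hS' hK1 fun j t ht => (hb j t ht).2
    have hDnorm : ∀ j x, ‖E₁.proj (S' j) (D x)‖ = a' j * ‖E₁.proj (S' j) x‖ := fun j x => by
      rw [hD, norm_smul, Complex.norm_real, NNReal.norm_eq]
    obtain ⟨R, hR⟩ := exists_equiv_factor (.of_nonneg (absOperator_nonneg T₁)) (.of_nonneg hD0)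
      (C := K)
      (fun x => E₁.norm_le_mul_norm_of_proj hS' hd hU E₁ (by positivity) fun j => by
        rw [hDnorm]
        exact hE₁.norm_proj_map_le hS' hK1 (fun j t ht => (hb j t ht).1) j x)
      (fun x => E₁.norm_le_mul_norm_of_proj hS' hd hU E₁ (by positivity) fun j => by
        rw [hDnorm]
        exact hE₁.le_norm_proj_map hS' hK1 (fun j t ht => (hb j t ht).2) j x)
    have habs : absOperator (T₁ ∘L R.toContinuousLinearMap) = D :=
      absOperator_comp_of_absOperator_mul_eq hD0 (by ext x; exact hR x)
    -- T' differs from T₁ only by an isomorphism of the domain, so the identity serves on the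
    -- target.
    refine ⟨T₁ ∘L R.toContinuousLinearMap, ⟨R.symm, .refl ℂ G₁, fun x => by simp⟩,
      fun B hB => ?_⟩
    obtain ⟨E', hE', hdim'⟩ := exists_dimSpectralMeasure_eq (T₁ ∘L R.toContinuousLinearMap)
    rw [habs] at hE'
    have hproj := SpectralMeasure.IsDecompositionOf.proj_diagonal hd hU hS' hD hE' hB
    -- The added cell has weight 0, so it occurs exactly when 0 ∈ B and contributes B ∩ {0}.
    have hunion : (⋃ j : {j // a' j ∈ B}, S' j) =
        (B ∩ {0}) ∪ ⋃ k : {k : ι // a k ∈ B}, S k := by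
      ext t
      simp only [mem_iUnion, mem_union, mem_inter_iff, mem_singleton_iff,
        Subtype.exists, Option.exists, exists_prop, S', a', Option.elim]
      grind
    have hsub : E'.subspace B = E₁.subspace ((B ∩ {0}) ∪ ⋃ k : {k : ι // a k ∈ B}, S k) := by
      rw [SpectralMeasure.subspace, SpectralMeasure.subspace, hproj, hunion]
    rw [hdim', hdim₁]
    simp only [hdim₁]
    rw [← E₁.hilbertDim_subspace_iUnion (S := fun k : {k : ι // a k ∈ B} => S k)
        (fun k => hS_meas k) (fun i j hij => hS_disj fun h => hij (Subtype.ext h)),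
      ← E₁.hilbertDim_subspace_union (hB.inter (measurableSet_singleton 0))
        (.iUnion fun k : {k : ι // a k ∈ B} => hS_meas k)]
    · exact hilbertDim_congr hsub
    · refine disjoint_left.2 fun t ht ht' => ?_
      obtain ⟨k, hk⟩ := mem_iUnion.1 ht'
      exact hS0 k (ht.2 ▸ hk)
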